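/- **Notation.** Let $\alpha=e^{2\pi i/3}$ and $a\in\mathbb R$, and let $\nu$ be the function, holomorphic on $\{27|\lambda|^6>4|a|^3\}$, with $\nu(\lambda)^3-a\,\nu(\lambda)=\lambda^3$ and $\nu(\lambda)=\lambda+O(\lambda^{-1})$ as $\lambda\to\infty$. Fix $R>0$ with $27R^6>4|a|^3$, $\epsilon>0$ and $\delta\in(0,\pi/6)$. Let $D=\{\lambda\in\mathbb C: |\lambda|>R,\ -\tfrac{2\pi}3<\arg\lambda<-\tfrac{\pi}3\}$, with positively oriented boundary $\partial D$, and let $A=\{Re^{i\mu}:\mu\in[-\tfrac{2\pi}3,-\tfrac{\pi}3]\}$. Let $$S=\{\alpha^2(z-iy):z\ge R,\,0\le y\le\epsilon\}\cup\{\alpha(-z-iy):z\ge R,\,0\le y\le\epsilon\}\cup A,$$ $$s=\{re^{i\mu}: r\ge R,\ \mu\in[-\tfrac{2\pi}3,-\tfrac{2\pi}3+\delta]\cup[-\tfrac{\pi}3-\delta,-\tfrac{\pi}3]\}\cup A.$$ Let $\Gamma$ be the contour formed of the rays $\{\alpha(-z-i\epsilon):z\ge R\}$ (inwards), the segment from $\alpha(-R-i\epsilon)$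 to $-\alpha R$, the arc $A$ from $-\alpha R$ to $\alpha^2R$, the segment from $\alpha^2R$ to $\alpha^2(R-i\epsilon)$, and the ray $\{\alpha^2(z-i\epsilon):z\ge R\}$ (outwards). Let $\gamma$ be the positively oriented boundary of $\{|\lambda|>R,\ -\tfrac{2\pi}3+\delta<\arg\lambda<-\tfrac{\pi}3-\delta\}$. **Lemma.** Fix $\tau>\tau'\ge0$. Suppose that $\theta\in L^1\cap L^\infty(\partial D)$ may be represented on $\partial D$ as $$\theta(\lambda)=e^{i\lambda^3\tau'}\phi(\lambda)+e^{i\lambda^3\tau}\tilde\phi(\lambda)+\psi(\lambda),$$ where $\psi\in L^1\cap L^\infty(\partial D)$ with $\psi(\lambda)=O(\lambda^{-4})$ as $\lambda\to\infty$ along $\partial D$; $\phi$ extends continuously to $S$, is holomorphic in the interior of $S$, and $\lim_{C\to\infty}\max_{\lambda\in S,|\lambda|=C}|\phi(\lambda)|=0$; and $\tilde\phi$ extends continuously to $s$, is holomorphic in the interior of $s$, and $\lim_{C\to\infty}\max_{\lambda\in s,|\lambda|=C}|\tilde\phi(\lambda)|=0$. Then, for $k\in\{0,1,2\}$ and all $t\in(\tau',\tau)$,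 if $j\in\{1,2\}$, $$(-i)^k\lim_{x\to0^+}\partial_x^k\left[\int_{\partial D}e^{i\nu(\alpha^j\lambda)x-i\lambda^3t}\theta(\lambda)\,d\lambda\right]=\int_{\partial D}e^{-i\lambda^3t}\psi(\lambda)\nu(\alpha^j\lambda)^k\,d\lambda+\int_\Gamma e^{-i\lambda^3(t-\tau')}\phi(\lambda)\nu(\alpha^j\lambda)^k\,d\lambda+\int_\gamma e^{i\lambda^3(\tau-t)}\tilde\phi(\lambda)\nu(\alpha^j\lambda)^k\,d\lambda,$$ and $$(-i)^k\lim_{x\to0^-}\partial_x^k\left[\int_{\partial D}e^{i\nu(\lambda)x-i\lambda^3t}\theta(\lambda)\,d\lambda\right]=\int_{\partial D}e^{-i\lambda^3t}\psi(\lambda)\nu(\lambda)^k\,d\lambda+\int_\Gamma e^{-i\lambda^3(t-\tau')}\phi(\lambda)\nu(\lambda)^k\,d\lambda+\int_\gamma e^{i\lambda^3(\tau-t)}\tilde\phi(\lambda)\nu(\lambda)^k\,d\lambda.$$ All integrals involved (those on the left for $x>0$, respectively $x<0$) converge absolutely, and the bracketed functions of $x$ are $k$ times continuously differentiable for $x>0$,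 respectively $x<0$. -/

import Mathlib

open Real Set Filter Topology MeasureTheory Asymptotics Bornology

namespace LKdV

noncomputable section

/-- The primitive cube root of unity `α = e^{2πi/3}`. -/
def alpha : ℂ := Complex.exp (2 * π * Complex.I / 3)

/-! ### The function `ν` -/

/-- Auxiliary factor in Cardano's formula, `c(z) = ((1 + √(1 - 4a³/(27z⁶))) / 2)^{1/3}`,
with principal branches. -/
def nuFactor (a : ℝ) (z : ℂ) : ℂ :=
  ((1 + (1 - 4 * (a : ℂ) ^ 3 / (27 * z ^ 6)) ^ (1 / 2 : ℂ)) / 2) ^ (1 / 3 : ℂ)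

/-- The branch `ν` of the solution of `ν³ - a ν = z³` with `ν(z) = z + O(1/z)` at infinity,
given by Cardano's formula. It is holomorphic where `27 |z|⁶ > 4 |a|³`; its branch points lie
on the circle `27 |z|⁶ = 4 |a|³`. The facts `nu_cubic`, `tendsto_nu` and `differentiableAt_nu`
below show that this is the intended function. -/
def nu (a : ℝ) (z : ℂ) : ℂ := z * nuFactor a z + a / (3 * z * nuFactor a z)

theorem re_sqrt_nonneg (w : ℂ) : 0 ≤ (w ^ (1 / 2 : ℂ)).re := by
  by_cases hw : w = 0
  · subst hw
    simp
  · rw [Complex.cpow_def_of_ne_zero hw, Complex.exp_re]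
    have h1 : (Complex.log w * (1 / 2 : ℂ)).im = w.arg / 2 := by
      have : (Complex.log w * (1 / 2 : ℂ)) = ((1 / 2 : ℝ) : ℂ) * Complex.log w := by
        push_cast; ring
      rw [this, Complex.im_ofReal_mul, Complex.log_im]
      ring
    rw [h1]
    apply mul_nonneg (Real.exp_pos _).le
    apply Real.cos_nonneg_of_neg_pi_div_two_le_of_le
    · linarith [Complex.neg_pi_lt_arg w]
    · linarith [Complex.arg_le_pi w]

theorem re_half_pos (w : ℂ) : 0 < ((1 + w ^ (1 / 2 : ℂ)) / 2).re := by
  have h := re_sqrt_nonneg w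
  have h2 : ((1 + w ^ (1 / 2 : ℂ)) / 2).re = (1 + (w ^ (1 / 2 : ℂ)).re) / 2 := by
    rw [show (2 : ℂ) = ((2 : ℝ) : ℂ) by norm_num, Complex.div_ofReal_re]
    simp
  rw [h2]
  linarith

theorem nuFactor_ne_zero (a : ℝ) (z : ℂ) : nuFactor a z ≠ 0 := by
  unfold nuFactor
  have h := re_half_pos (1 - 4 * (a : ℂ) ^ 3 / (27 * z ^ 6))
  rw [Ne, Complex.cpow_eq_zero_iff]
  rintro ⟨h0, -⟩
  rw [h0] at h
  simp at h

theorem nu_cubic (a : ℝ) {z : ℂ} (hz : z ≠ 0) : nu a z ^ 3 - a * nu a z = z ^ 3 := by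
  have hc := nuFactor_ne_zero a z
  have hc3 : nuFactor a z ^ 3 =
      (1 + (1 - 4 * (a : ℂ) ^ 3 / (27 * z ^ 6)) ^ (1 / 2 : ℂ)) / 2 := by
    have := Complex.cpow_nat_inv_pow
      ((1 + (1 - 4 * (a : ℂ) ^ 3 / (27 * z ^ 6)) ^ (1 / 2 : ℂ)) / 2) (n := 3) (by norm_num)
    unfold nuFactor
    convert this using 3
    norm_num
  have hw : ((1 - 4 * (a : ℂ) ^ 3 / (27 * z ^ 6)) ^ (1 / 2 : ℂ)) ^ 2 =
      1 - 4 * (a : ℂ) ^ 3 / (27 * z ^ 6) := by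
    have := Complex.cpow_nat_inv_pow (1 - 4 * (a : ℂ) ^ 3 / (27 * z ^ 6)) (n := 2) (by norm_num)
    convert this using 3
    norm_num
  set w := (1 - 4 * (a : ℂ) ^ 3 / (27 * z ^ 6)) ^ (1 / 2 : ℂ)
  have hw2 : w = 2 * nuFactor a z ^ 3 - 1 := by rw [hc3]; ring
  rw [hw2] at hw
  unfold nu
  set c := nuFactor a z
  field_simp at hw ⊢
  linear_combination (1 / 4 : ℂ) * hw

theorem nuFactor_differentiableAt (a : ℝ) {z : ℂ} (hz : 4 * |a| ^ 3 < 27 * ‖z‖ ^ 6) :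
    DifferentiableAt ℂ (nuFactor a) z := by
  have hz0 : z ≠ 0 := by
    rintro rfl
    simp at hz
    have := abs_nonneg a
    have : 0 ≤ |a| ^ 3 := by positivity
    linarith
  have hsmall : ‖4 * (a : ℂ) ^ 3 / (27 * z ^ 6)‖ < 1 := by
    have h27 : 0 < 27 * ‖z‖ ^ 6 := by positivity
    simp only [norm_div, norm_mul, norm_pow, Complex.norm_real, Real.norm_eq_abs,
      Complex.norm_ofNat]
    rwa [div_lt_one h27]
  have hre : 0 < (1 - 4 * (a : ℂ) ^ 3 / (27 * z ^ 6)).re := by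
    have := Complex.abs_re_le_norm (4 * (a : ℂ) ^ 3 / (27 * z ^ 6))
    have := le_abs_self (4 * (a : ℂ) ^ 3 / (27 * z ^ 6)).re
    rw [Complex.sub_re, Complex.one_re]
    linarith
  unfold nuFactor
  apply DifferentiableAt.cpow_const
  · apply DifferentiableAt.div_const
    apply DifferentiableAt.const_add
    apply DifferentiableAt.cpow_const
    · apply DifferentiableAt.const_sub
      apply DifferentiableAt.div
      · fun_prop
      · fun_prop
      · simpa using hz0
    · exact Or.inl hre
  · exact Or.inl (re_half_pos _)

theorem differentiableAt_nu (a : ℝ) {z : ℂ} (hz : 4 * |a| ^ 3 < 27 * ‖z‖ ^ 6) :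
    DifferentiableAt ℂ (nu a) z := by
  have hz0 : z ≠ 0 := by
    rintro rfl
    simp at hz
    have := abs_nonneg a
    have : 0 ≤ |a| ^ 3 := by positivity
    linarith
  have h := nuFactor_differentiableAt a hz
  have hc := nuFactor_ne_zero a z
  unfold nu
  apply DifferentiableAt.add
  · exact differentiableAt_id.mul h
  · apply DifferentiableAt.div
    · fun_prop
    · exact (by fun_prop : DifferentiableAt ℂ (fun z : ℂ => 3 * z) z).mul h
    · simp [hz0, hc]

theorem tendsto_nuFactor (a : ℝ) : Tendsto (nuFactor a) (cobounded ℂ) (𝓝 1) := by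
  have h0 : Tendsto (fun z : ℂ => 4 * (a : ℂ) ^ 3 / (27 * z ^ 6)) (cobounded ℂ) (𝓝 0) := by
    have h := (tendsto_inv₀_cobounded (α := ℂ)).pow 6
    have h' := h.const_mul (4 * (a : ℂ) ^ 3 / 27)
    simp only [ne_eq, OfNat.ofNat_ne_zero, not_false_eq_true, zero_pow, mul_zero] at h'
    refine h'.congr fun z => ?_
    rw [inv_pow, ← div_eq_mul_inv, div_div]
  have hcont : ContinuousAt
      (fun w : ℂ => ((1 + (1 - w) ^ (1 / 2 : ℂ)) / 2) ^ (1 / 3 : ℂ)) 0 := by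
    apply ContinuousAt.cpow
    · apply ContinuousAt.div_const
      apply ContinuousAt.add continuousAt_const
      apply ContinuousAt.cpow
      · fun_prop
      · fun_prop
      · simp
    · fun_prop
    · exact Or.inl (re_half_pos _)
  have h1 := hcont.tendsto.comp h0
  have h2 : ((1 + (1 - (0 : ℂ)) ^ (1 / 2 : ℂ)) / 2) ^ (1 / 3 : ℂ) = 1 := by norm_num
  rw [h2] at h1
  exact h1

theorem tendsto_nu (a : ℝ) :
    Tendsto (fun z => z * (nu a z - z)) (cobounded ℂ) (𝓝 ((a : ℂ) / 3)) := by
  have hne : ∀ᶠ z : ℂ in cobounded ℂ, z ≠ 0 := by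
    filter_upwards [eventually_ne_cobounded (0 : ℂ)] with z hz using hz
  have hq : Tendsto (fun z => nu a z / z) (cobounded ℂ) (𝓝 1) := by
    have h1 := tendsto_nuFactor a
    have h2 := (tendsto_inv₀_cobounded (α := ℂ)).pow 2
    have h3 := h1.add ((h2.mul (h1.inv₀ one_ne_zero)).const_mul ((a : ℂ) / 3))
    simp only [ne_eq, OfNat.ofNat_ne_zero, not_false_eq_true, zero_pow, mul_zero, add_zero,
      zero_mul] at h3
    refine h3.congr' ?_
    filter_upwards [hne] with z hz
    have hc := nuFactor_ne_zero a z
    unfold nu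
    field_simp
  have hden := ((hq.pow 2).add hq).add_const 1
  have hlim := (hq.const_mul (a : ℂ)).div hden (by norm_num)
  have h3 : (a : ℂ) * 1 / (1 ^ 2 + 1 + 1) = a / 3 := by norm_num
  rw [h3] at hlim
  refine hlim.congr' ?_
  have hdne : ∀ᶠ z : ℂ in cobounded ℂ, (nu a z / z) ^ 2 + nu a z / z + 1 ≠ 0 :=
    hden.eventually_ne (by norm_num)
  filter_upwards [hne, hdne] with z hz hd
  rw [Pi.div_apply, div_eq_iff hd]
  have hcub := nu_cubic a hz
  field_simp
  linear_combination -hcub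

/-! ### Contours -/

/-- A smooth piece of an oriented contour: the curve `path` restricted to the parameter set
`dom`, traversed in the direction of increasing parameter. -/
structure Piece where
  /-- the parameter set, an interval -/
  dom : Set ℝ
  /-- the parametrization -/
  path : ℝ → ℂ

/-- A piecewise smooth oriented contour: its pieces in the order of traversal. -/
abbrev Contour := List Piece

/-- The set of points of a contour. -/
def Contour.carrier (c : Contour) : Set ℂ := {z | ∃ p ∈ c, z ∈ p.path '' p.dom}

/-- The arc length measure of a contour. -/
def Contour.arcLength (c : Contour) : Measure ℂ :=
  (c.map fun p => ((volume.restrict p.dom).withDensity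
    fun u => ENNReal.ofReal ‖deriv p.path u‖).map p.path).sum

/-- The contour integral `∫_c f(z) dz`. -/
def Contour.integral (c : Contour) (f : ℂ → ℂ) : ℂ :=
  (c.map fun p => ∫ u in p.dom, f (p.path u) * deriv p.path u).sum

/-- Absolute convergence of the contour integral `∫_c f(z) dz`. -/
def Contour.Converges (c : Contour) (f : ℂ → ℂ) : Prop :=
  ∀ p ∈ c, IntegrableOn (fun u => f (p.path u) * deriv p.path u) p.dom

/-- The positively oriented boundary `∂D` of
`D = {z : |z| > R, -2π/3 < arg z < -π/3}`: in from infinity along the ray of argument `-π/3`,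
along the arc `|z| = R`, and out along the ray of argument `-2π/3`. -/
def bdryD (R : ℝ) : Contour :=
  [⟨Iic (-R), fun u => alpha * u⟩,
   ⟨Icc (π / 3) (2 * π / 3), fun u => R * Complex.exp (-(Complex.I * u))⟩,
   ⟨Ici R, fun u => alpha ^ 2 * u⟩]

/-- The closed set `S`: two semistrips of width `ε` adjacent to the rays of `∂D`, on the side
away from `D`, together with the arc of `∂D`. -/
def stripS (R ε : ℝ) : Set ℂ :=
  {z | ∃ u y : ℝ, R ≤ u ∧ 0 ≤ y ∧ y ≤ ε ∧
      (z = alpha ^ 2 * (u - Complex.I * y) ∨ z = alpha * (-u - Complex.I * y))} ∪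
  {z | ∃ μ : ℝ, -(2 * π / 3) ≤ μ ∧ μ ≤ -(π / 3) ∧ z = R * Complex.exp (Complex.I * μ)}

/-- The contour `Γ`: `∂D` with its rays moved across `S`, a distance `ε` away from `D`, and
joined to the arc by segments of length `ε`. -/
def contourGamma (R ε : ℝ) : Contour :=
  [⟨Iic (-R), fun u => alpha * (u - Complex.I * ε)⟩,
   ⟨Icc (-ε) 0, fun u => alpha * (-R + Complex.I * u)⟩,
   ⟨Icc (π / 3) (2 * π / 3), fun u => R * Complex.exp (-(Complex.I * u))⟩,
   ⟨Icc 0 ε, fun u => alpha ^ 2 * (R - Complex.I * u)⟩,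
   ⟨Ici R, fun u => alpha ^ 2 * (u - Complex.I * ε)⟩]

/-- The closed set `s`: two truncated sectors of opening `δ` adjacent to the rays of `∂D`, on
the side of `D`, together with the arc of `∂D`. -/
def sectorS (R δ : ℝ) : Set ℂ :=
  {z | ∃ r μ : ℝ, R ≤ r ∧
      (-(2 * π / 3) ≤ μ ∧ μ ≤ -(2 * π / 3) + δ ∨ -(π / 3) - δ ≤ μ ∧ μ ≤ -(π / 3)) ∧
      z = r * Complex.exp (Complex.I * μ)} ∪
  {z | ∃ μ : ℝ, -(2 * π / 3) ≤ μ ∧ μ ≤ -(π / 3) ∧ z = R * Complex.exp (Complex.I * μ)}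

/-- The contour `γ`: `∂D` with its rays rotated across `s`, by the angle `δ` into `D`; that is,
the positively oriented boundary of `{z : |z| > R, -2π/3 + δ < arg z < -π/3 - δ}`. -/
def contourGammaIn (R δ : ℝ) : Contour :=
  [⟨Iic (-R), fun u => alpha * Complex.exp (-(Complex.I * δ)) * u⟩,
   ⟨Icc (π / 3 + δ) (2 * π / 3 - δ), fun u => R * Complex.exp (-(Complex.I * u))⟩,
   ⟨Ici R, fun u => alpha ^ 2 * Complex.exp (Complex.I * δ) * u⟩]

/-- The exponential kernel `E_j(z; x, t) = exp(i ν(α^j z) x - i z³ t)`. -/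
def kernelE (a : ℝ) (j : ℕ) (x t : ℝ) (z : ℂ) : ℂ :=
  Complex.exp (Complex.I * nu a (alpha ^ j * z) * x - Complex.I * z ^ 3 * t)

/-- The function `x ↦ ∫_{∂D} E_j(z; x, t) θ(z) dz`. -/
def bdryIntegral (a R : ℝ) (j : ℕ) (t : ℝ) (θ : ℂ → ℂ) (x : ℝ) : ℂ :=
  (bdryD R).integral fun z => kernelE a j x t z * θ z

end

end LKdV

/-! The variable `x` enters only through `e^{i N x}` with `N(z) = ν(α^j z)`, and `x`-derivatives
bring down powers of `N`. On `∂D` itself the integrand is too large for that, because `φ` and `φt`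
merely tend to zero. The remedy is to move those two terms, for each fixed `x`, to contours where
they decay rapidly.

The amplitude `e^{-i z³ s}` has modulus `exp(s Im z³)`. On the rays of `∂D` the cube `z³` is real.
Shifting a ray into `S` makes `Im z³` negative of order `r²` (`Ray.im_cube_shift_le`), and rotating
it into `s` makes `Im z³` positive of order `r³` (`Ray.le_im_cube_rotate`). Since `t - τ' > 0 > t -
τ`, the `φ` term decays on the shifted rays of `Γ` and the `φt` term on the rotated rays of `γ`. The
factor `e^{i N x}` does no harm: on `S ∪ s` the point `α^j z` stays within `ε` of the favourable
half-plane (`le_im_alpha_mul`) and `ν(z) - z` is bounded (`exists_norm_nu_sub_le`), so its modulus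
is at most `e^{M|x|}`.

Cauchy's theorem on truncated regions, with closing pieces that vanish in the limit, gives the
deformation along one ray (`Ray.integral_eq`) and then along the contour (`integral_bdryD_eq`). The
`ψ` term stays on `∂D`: against `O(z⁻⁴)` two powers of `N` are affordable. All three integrals now
converge absolutely even with the factor `N^k`, so dominated convergence justifies both the
derivatives and the limit at `0` (`Contour.tendsto_iteratedDeriv_integral_exp_mul`);
`limit_of_phase` combines the two halves. -/

namespace LKdV

/-! ### Cauchy's theorem along truncated rays: shift and rotation -/

/-- Cauchy's theorem for the image of a rectangle `[a, b] × [0, h]` under a holomorphic map `Φ`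
with nonvanishing derivative. -/
theorem integral_eq_of_comp_rect {F Φ Φ' : ℂ → ℂ} {K : Set ℂ} {a b h : ℝ} (hab : a ≤ b)
    (hΦ : ∀ w, HasStrictDerivAt Φ (Φ' w) w) (hΦ' : Differentiable ℂ Φ') (hne : ∀ w, Φ' w ≠ 0)
    (hK : ∀ s y : ℝ, a ≤ s → y ∈ uIcc 0 h → Φ (s + y * Complex.I) ∈ K)
    (hc : ContinuousOn F K) (hd : DifferentiableOn ℂ F (interior K)) :
    ∫ s in a..b, F (Φ s) * Φ' s =
      (∫ y in (0 : ℝ)..h,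
        F (Φ (a + y * Complex.I)) * (Φ' (a + y * Complex.I) * Complex.I))
      + (∫ s in a..b, F (Φ (s + h * Complex.I)) * Φ' (s + h * Complex.I))
      - ∫ y in (0 : ℝ)..h,
        F (Φ (b + y * Complex.I)) * (Φ' (b + y * Complex.I) * Complex.I) := by
  have hΦc : Differentiable ℂ Φ := fun w => (hΦ w).hasDerivAt.differentiableAt
  have hmem : ∀ w : ℂ, a ≤ w.re → w.im ∈ uIcc 0 h → Φ w ∈ K := fun w h1 h2 => by
    simpa using hK w.re w.im h1 h2
  have key := Complex.integral_boundary_rect_eq_zero_of_continuousOn_of_differentiableOn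
    (fun w => F (Φ w) * Φ' w) ⟨a, 0⟩ ⟨b, h⟩ ?_ ?_
  · simp only [Complex.ofReal_zero, zero_mul, add_zero, smul_eq_mul] at key
    simp only [← mul_assoc, intervalIntegral.integral_mul_const]
    linear_combination key
  · refine ContinuousOn.mul (hc.comp hΦc.continuous.continuousOn ?_) hΦ'.continuous.continuousOn
    intro w hw
    rw [Complex.mem_reProdIm, uIcc_of_le hab] at hw
    exact hmem w hw.1.1 hw.2
  · intro w hw
    refine DifferentiableAt.differentiableWithinAt ?_
    refine DifferentiableAt.mul ?_ hΦ'.differentiableAt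
    -- A nonzero strict derivative makes `Φ` open at `w`, so the open rectangle is sent into the
    -- interior of `K`, the only place where `F` is known to be holomorphic.
    have hmap := (hΦ w).map_nhds_eq (hne w)
    have hint : Φ w ∈ interior K := by
      rw [mem_interior_iff_mem_nhds, ← hmap, mem_map]
      have ho : IsOpen (Ioo (min a b) (max a b) ×ℂ Ioo (min 0 h) (max 0 h)) :=
        isOpen_Ioo.reProdIm isOpen_Ioo
      filter_upwards [ho.mem_nhds hw] with v hv
      rw [Complex.mem_reProdIm, min_eq_left hab] at hv
      exact hmem v hv.1.1.le (Ioo_subset_Icc_self hv.2)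
    exact ((hd _ hint).differentiableAt (isOpen_interior.mem_nhds hint)).comp w hΦc.differentiableAt

/-- Shifting the integral along a segment of a ray by the height `h`. -/
theorem integral_ray_eq_shift {F : ℂ → ℂ} {K : Set ℂ} {β : ℂ} (hβ : β ≠ 0) {R C h : ℝ}
    (hC : R ≤ C)
    (hK : ∀ r y : ℝ, R ≤ r → y ∈ uIcc 0 h → β * (r + y * Complex.I) ∈ K)
    (hc : ContinuousOn F K) (hd : DifferentiableOn ℂ F (interior K)) :
    ∫ r in R..C, F (β * r) * β =
      (∫ y in (0 : ℝ)..h, F (β * (R + y * Complex.I)) * (β * Complex.I))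
      + (∫ r in R..C, F (β * (r + h * Complex.I)) * β)
      - ∫ y in (0 : ℝ)..h, F (β * (C + y * Complex.I)) * (β * Complex.I) := by
  refine integral_eq_of_comp_rect (Φ := fun w => β * w) (Φ' := fun _ => β) hC (fun w => ?_)
    (by fun_prop) (fun _ => hβ) hK hc hd
  simpa using (hasStrictDerivAt_id w).const_mul β

/-- Change of variables `r = e^s` in an integral along a segment of a ray. -/
theorem integral_ray_exp {G : ℂ → ℂ} {R C : ℝ} (hR : 0 < R) (hC : R ≤ C) (β : ℂ)
    (hG : ContinuousOn (fun r : ℝ => G (β * r)) (Ici R)) :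
    ∫ s in Real.log R..Real.log C, G (β * Complex.exp s) * (β * Complex.exp s) =
      ∫ r in R..C, G (β * r) * β := by
  have hC0 : 0 < C := hR.trans_le hC
  have hlog : Real.log R ≤ Real.log C := Real.log_le_log hR hC
  have key := intervalIntegral.integral_deriv_smul_comp' (f := Real.exp) (f' := Real.exp)
    (g := fun r : ℝ => G (β * r) * β) (a := Real.log R) (b := Real.log C)
    (fun x _ => Real.hasDerivAt_exp x) Real.continuous_exp.continuousOn ?_
  · rw [Real.exp_log hR, Real.exp_log hC0] at key
    rw [← key]
    refine intervalIntegral.integral_congr fun s _ => ?_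
    simp only [Function.comp, Complex.real_smul, Complex.ofReal_exp]
    ring
  · refine ContinuousOn.mul (hG.mono ?_) continuousOn_const
    rintro _ ⟨s, hs, rfl⟩
    rw [uIcc_of_le hlog] at hs
    exact (Real.le_exp_log R).trans (Real.exp_le_exp.2 hs.1)

/-- Rotating the integral along a segment of a ray by the angle `h`. -/
theorem integral_ray_eq_rotate {F : ℂ → ℂ} {K : Set ℂ} {β : ℂ} (hβ : β ≠ 0) {R C h : ℝ}
    (hR : 0 < R) (hC : R ≤ C)
    (hK : ∀ r μ : ℝ, R ≤ r → μ ∈ uIcc 0 h → β * (r * Complex.exp (μ * Complex.I)) ∈ K)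
    (hc : ContinuousOn F K) (hd : DifferentiableOn ℂ F (interior K)) :
    ∫ r in R..C, F (β * r) * β =
      (∫ μ in (0 : ℝ)..h, F (β * (R * Complex.exp (μ * Complex.I))) *
        (β * (R * Complex.exp (μ * Complex.I)) * Complex.I))
      + (∫ r in R..C, F (β * Complex.exp (h * Complex.I) * r) * (β * Complex.exp (h * Complex.I)))
      - ∫ μ in (0 : ℝ)..h, F (β * (C * Complex.exp (μ * Complex.I))) *
        (β * (C * Complex.exp (μ * Complex.I)) * Complex.I) := by
  have hC0 : 0 < C := hR.trans_le hC
  have hlog : Real.log R ≤ Real.log C := Real.log_le_log hR hC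
  have hexpC : ∀ {x : ℝ}, 0 < x → Complex.exp (Real.log x) = x := fun hx => by
    rw [← Complex.ofReal_exp, Real.exp_log hx]
  -- In the coordinate `z = β e^w` a truncated sector is the rectangle `[log R, log C] × [0, h]`.
  have key := integral_eq_of_comp_rect (F := F) (K := K) (Φ := fun w => β * Complex.exp w)
    (Φ' := fun w => β * Complex.exp w) (h := h) hlog
    (fun w => (Complex.hasStrictDerivAt_exp w).const_mul β) (by fun_prop)
    (fun w => mul_ne_zero hβ (Complex.exp_ne_zero w)) (fun s y hs hy => ?_) hc hd
  · have hrot : ∀ s : ℝ, β * (Complex.exp s * Complex.exp (h * Complex.I)) =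
        β * Complex.exp (h * Complex.I) * Complex.exp s := fun s => by ring
    have hmem : ∀ μ ∈ uIcc 0 h, ContinuousOn
        (fun r : ℝ => F (β * Complex.exp (μ * Complex.I) * r)) (Ici R) := by
      intro μ hμ
      refine hc.comp (by fun_prop) fun r hr => ?_
      convert hK r μ hr hμ using 1
      ring
    have h0 := hmem 0 left_mem_uIcc
    simp only [Complex.ofReal_zero, zero_mul, Complex.exp_zero, mul_one] at h0
    simp only [Complex.exp_add, hexpC hR, hexpC hC0, hrot] at key
    rwa [integral_ray_exp hR hC β h0, integral_ray_exp hR hC _ (hmem h right_mem_uIcc)] at key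
  · have := hK (Real.exp s) y ((Real.le_exp_log R).trans (Real.exp_le_exp.2 hs)) hy
    simpa only [Complex.exp_add, Complex.ofReal_exp] using this

/-! ### Integrals of `e^{i p x}` depending on the parameter `x` -/

theorem norm_exp_I_mul_le {p : ℂ} {M x : ℝ} (h : -(M * |x|) ≤ x * p.im) :
    ‖Complex.exp (Complex.I * p * x)‖ ≤ Real.exp (M * |x|) := by
  rw [Complex.norm_exp, Real.exp_le_exp]
  have : (Complex.I * p * x).re = -(x * p.im) := by simp; ring
  rw [this]
  linarith

theorem integrable_exp_mul {μ : Measure ℝ} {p g : ℝ → ℂ} {M x : ℝ}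
    (hp : AEStronglyMeasurable p μ) (hM : ∀ᵐ u ∂μ, -(M * |x|) ≤ x * (p u).im)
    (hg : Integrable g μ) :
    Integrable (fun u => Complex.exp (Complex.I * p u * x) * g u) μ := by
  refine hg.bdd_mul (c := Real.exp (M * |x|)) ?_ ?_
  · exact Complex.continuous_exp.comp_aestronglyMeasurable
      ((hp.const_mul _).mul aestronglyMeasurable_const)
  · filter_upwards [hM] with u hu using norm_exp_I_mul_le hu

/-- The phase is controlled only for `x ∈ I`, in the applications a half-line. As `I` is open,
parameters near `x` stay in `I` and within distance `1`, where `e^{|M|(|x|+1)} ‖g p‖` dominates the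
derivative of the integrand. -/
theorem hasDerivAt_integral_exp_mul {μ : Measure ℝ} {p g : ℝ → ℂ} {I : Set ℝ} {M x : ℝ}
    (hI : IsOpen I) (hx : x ∈ I) (hp : AEStronglyMeasurable p μ)
    (hM : ∀ᵐ u ∂μ, ∀ x ∈ I, -(M * |x|) ≤ x * (p u).im)
    (hg : Integrable g μ) (hgp : Integrable (fun u => g u * p u) μ) :
    HasDerivAt (fun x : ℝ => ∫ u, Complex.exp (Complex.I * p u * x) * g u ∂μ)
      (Complex.I * ∫ u, Complex.exp (Complex.I * p u * x) * (g u * p u) ∂μ) x := by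
  rw [← integral_const_mul]
  have hs : I ∩ Metric.ball x 1 ∈ 𝓝 x :=
    inter_mem (hI.mem_nhds hx) (Metric.ball_mem_nhds x one_pos)
  refine (hasDerivAt_integral_of_dominated_loc_of_deriv_le hs
    (bound := fun u => Real.exp (|M| * (|x| + 1)) * ‖g u * p u‖)
    (F' := fun x u => Complex.I * (Complex.exp (Complex.I * p u * x) * (g u * p u)))
    ?_ ?_ ?_ ?_ ?_ ?_).2
  · filter_upwards [hs] with y hy
    exact (integrable_exp_mul hp (hM.mono fun u hu => hu y hy.1) hg).aestronglyMeasurable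
  · exact integrable_exp_mul hp (hM.mono fun u hu => hu x hx) hg
  · exact ((integrable_exp_mul hp (hM.mono fun u hu => hu x hx) hgp).const_mul _).1
  · filter_upwards [hM] with u hu y hy
    rw [norm_mul, Complex.norm_I, one_mul, norm_mul]
    refine mul_le_mul_of_nonneg_right ?_ (norm_nonneg _)
    refine (norm_exp_I_mul_le (hu y hy.1)).trans (Real.exp_le_exp.2 ?_)
    have h1 : |y| ≤ |x| + 1 := by
      have := hy.2
      rw [Metric.mem_ball, Real.dist_eq] at this
      have := abs_sub_abs_le_abs_sub y x
      linarith
    exact mul_le_mul (le_abs_self M) h1 (abs_nonneg _) (abs_nonneg _)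
  · exact hgp.norm.const_mul _
  · refine ae_of_all _ fun u y _ => ?_
    have h1 : HasDerivAt (fun y : ℝ => Complex.I * p u * y) (Complex.I * p u) y := by
      simpa using (Complex.ofRealCLM.hasDerivAt (x := y)).const_mul (Complex.I * p u)
    exact (h1.cexp.mul_const (g u)).congr_deriv (by ring)

/-- The point `x` need not belong to `I`: the case of interest is `x = 0`, the endpoint of a
half-line. -/
theorem continuousWithinAt_integral_exp_mul {μ : Measure ℝ} {p g : ℝ → ℂ} {I : Set ℝ} {M : ℝ}
    (x : ℝ) (hp : AEStronglyMeasurable p μ)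
    (hM : ∀ᵐ u ∂μ, ∀ x ∈ I, -(M * |x|) ≤ x * (p u).im) (hg : Integrable g μ) :
    ContinuousWithinAt (fun x : ℝ => ∫ u, Complex.exp (Complex.I * p u * x) * g u ∂μ) I x := by
  have hs : I ∩ Metric.ball x 1 ∈ 𝓝[I] x :=
    inter_mem self_mem_nhdsWithin (mem_nhdsWithin_of_mem_nhds (Metric.ball_mem_nhds x one_pos))
  refine continuousWithinAt_of_dominated
    (bound := fun u => Real.exp (|M| * (|x| + 1)) * ‖g u‖) ?_ ?_ (hg.norm.const_mul _) ?_
  · filter_upwards [hs] with y hy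
    exact (integrable_exp_mul hp (hM.mono fun u hu => hu y hy.1) hg).aestronglyMeasurable
  · filter_upwards [hs] with y hy
    filter_upwards [hM] with u hu
    rw [norm_mul]
    refine mul_le_mul_of_nonneg_right ?_ (norm_nonneg _)
    refine (norm_exp_I_mul_le (hu y hy.1)).trans (Real.exp_le_exp.2 ?_)
    have h1 : |y| ≤ |x| + 1 := by
      have := hy.2
      rw [Metric.mem_ball, Real.dist_eq] at this
      have := abs_sub_abs_le_abs_sub y x
      linarith
    exact mul_le_mul (le_abs_self M) h1 (abs_nonneg _) (abs_nonneg _)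
  · exact ae_of_all _ fun u => by fun_prop

/-! ### Exponential integrals over contours -/

/-- On the contour `c` the phase `N` is measurable and `exp(i N x)` is bounded by `exp(M |x|)`
for `x ∈ I`. -/
structure Contour.PhaseBound (c : Contour) (N : ℂ → ℂ) (I : Set ℝ) (M : ℝ) : Prop where
  meas : ∀ p ∈ c, AEStronglyMeasurable (fun u => N (p.path u)) (volume.restrict p.dom)
  bound : ∀ p ∈ c, ∀ᵐ u ∂(volume.restrict p.dom), ∀ x ∈ I,
    -(M * |x|) ≤ x * (N (p.path u)).im

theorem Contour.PhaseBound.of_cons {p : Piece} {c : Contour} {N : ℂ → ℂ} {I : Set ℝ} {M : ℝ}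
    (h : Contour.PhaseBound (p :: c) N I M) : Contour.PhaseBound c N I M :=
  ⟨fun q hq => h.meas q (List.mem_cons_of_mem _ hq),
    fun q hq => h.bound q (List.mem_cons_of_mem _ hq)⟩

theorem Contour.Converges.of_cons {p : Piece} {c : Contour} {f : ℂ → ℂ}
    (h : Contour.Converges (p :: c) f) : Contour.Converges c f :=
  fun q hq => h q (List.mem_cons_of_mem _ hq)

theorem Contour.integral_cons (p : Piece) (c : Contour) (f : ℂ → ℂ) :
    Contour.integral (p :: c) f =
      (∫ u in p.dom, f (p.path u) * deriv p.path u) + c.integral f := by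
  simp [Contour.integral]

variable {c : Contour} {N g : ℂ → ℂ} {I : Set ℝ} {M : ℝ}

theorem Contour.Converges.exp_mul (hb : c.PhaseBound N I M) (hg : c.Converges g) {x : ℝ}
    (hx : x ∈ I) : c.Converges fun z => Complex.exp (Complex.I * N z * x) * g z := by
  intro p hp
  have := integrable_exp_mul (hb.meas p hp) ((hb.bound p hp).mono fun u hu => hu x hx) (hg p hp)
  simpa only [IntegrableOn, mul_assoc] using this

theorem Contour.hasDerivAt_integral_exp_mul (hI : IsOpen I) (hb : c.PhaseBound N I M)
    (hg : c.Converges g) (hgN : c.Converges fun z => g z * N z) {x : ℝ} (hx : x ∈ I) :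
    HasDerivAt (fun x : ℝ => c.integral fun z => Complex.exp (Complex.I * N z * x) * g z)
      (Complex.I * c.integral fun z => Complex.exp (Complex.I * N z * x) * (g z * N z)) x := by
  induction c with
  | nil => simpa [Contour.integral] using hasDerivAt_const x (0 : ℂ)
  | cons p c ih =>
    simp only [Contour.integral_cons, mul_add]
    refine HasDerivAt.add ?_ (ih hb.of_cons hg.of_cons hgN.of_cons)
    have hp : p ∈ p :: c := List.mem_cons_self
    have hgN' := hgN p hp
    simp only [IntegrableOn, mul_right_comm (g _)] at hgN'
    have := LKdV.hasDerivAt_integral_exp_mul hI hx (hb.meas p hp) (hb.bound p hp) (hg p hp) hgN'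
    simpa only [mul_assoc, mul_comm (N _) (deriv _ _)] using this

theorem Contour.continuousWithinAt_integral_exp_mul (hb : c.PhaseBound N I M)
    (hg : c.Converges g) (x : ℝ) : ContinuousWithinAt
      (fun x : ℝ => c.integral fun z => Complex.exp (Complex.I * N z * x) * g z) I x := by
  induction c with
  | nil => simpa [Contour.integral] using continuousWithinAt_const
  | cons p c ih =>
    simp only [Contour.integral_cons]
    refine ContinuousWithinAt.add ?_ (ih hb.of_cons hg.of_cons)
    have hp : p ∈ p :: c := List.mem_cons_self
    simpa only [mul_assoc] using
      LKdV.continuousWithinAt_integral_exp_mul x (hb.meas p hp) (hb.bound p hp) (hg p hp)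

theorem Contour.tendsto_integral_exp_mul (hb : c.PhaseBound N I M) (hg : c.Converges g) :
    Tendsto (fun x : ℝ => c.integral fun z => Complex.exp (Complex.I * N z * x) * g z) (𝓝[I] 0)
      (𝓝 (c.integral g)) := by
  simpa using (Contour.continuousWithinAt_integral_exp_mul hb hg 0).tendsto

/-- Each derivative replaces `g` by `g * N` up to the factor `i`. The induction therefore runs over
all amplitudes: the hypothesis for `k + 1` and `g` contains the hypothesis for `k` and `g * N`. -/
theorem Contour.contDiffOn_integral_exp_mul (hI : IsOpen I) (hb : c.PhaseBound N I M) {k : ℕ}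
    (hg : ∀ m ≤ k, c.Converges fun z => g z * N z ^ m) :
    ContDiffOn ℝ k
      (fun x : ℝ => c.integral fun z => Complex.exp (Complex.I * N z * x) * g z) I := by
  have hD : ∀ {g : ℂ → ℂ}, (∀ m ≤ 1, c.Converges fun z => g z * N z ^ m) → ∀ x ∈ I, _ :=
    fun {g} hg x hx => Contour.hasDerivAt_integral_exp_mul (g := g) hI hb
      (by simpa using hg 0 zero_le_one) (by simpa using hg 1 le_rfl) hx
  induction k generalizing g with
  | zero =>
    rw [Nat.cast_zero, contDiffOn_zero]
    exact fun x _ => Contour.continuousWithinAt_integral_exp_mul hb (by simpa using hg 0 le_rfl) x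
  | succ k ih =>
    have hd := fun x hx => hD (fun m hm => hg m (hm.trans (by omega))) x hx
    rw [Nat.cast_add, Nat.cast_one, contDiffOn_succ_iff_deriv_of_isOpen hI]
    refine ⟨fun x hx => (hd x hx).differentiableAt.differentiableWithinAt, by simp, ?_⟩
    refine ContDiffOn.congr (f := fun x : ℝ => Complex.I *
      c.integral fun z => Complex.exp (Complex.I * N z * x) * (g z * N z)) ?_
      fun x hx => (hd x hx).deriv
    refine contDiffOn_const.mul (ih fun m hm => ?_)
    convert hg (m + 1) (by omega) using 2 with z
    ring

theorem Contour.iteratedDeriv_integral_exp_mul (hI : IsOpen I) (hb : c.PhaseBound N I M) {k : ℕ}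
    (hg : ∀ m ≤ k, c.Converges fun z => g z * N z ^ m) {x : ℝ} (hx : x ∈ I) :
    iteratedDeriv k
      (fun x : ℝ => c.integral fun z => Complex.exp (Complex.I * N z * x) * g z) x =
    Complex.I ^ k *
      c.integral fun z => Complex.exp (Complex.I * N z * x) * (g z * N z ^ k) := by
  induction k generalizing x with
  | zero => simp
  | succ k ih =>
    rw [iteratedDeriv_succ]
    have heq := eventuallyEq_of_mem (hI.mem_nhds hx)
      fun y hy => ih (fun m hm => hg m (by omega)) (x := y) hy
    rw [heq.deriv_eq]
    have hd := (Contour.hasDerivAt_integral_exp_mul hI hb (hg k (by omega))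
      (by simpa only [mul_assoc, ← pow_succ] using hg (k + 1) le_rfl) hx).const_mul
        (Complex.I ^ k)
    rw [hd.deriv, ← mul_assoc, ← pow_succ]
    simp only [mul_assoc, ← pow_succ]

/-- The derivatives are taken only inside `I`, where they are again exponential integrals; `(-i)^k`
cancels the `i^k` that they produce. The limit is then continuity within `I` at `0`. -/
theorem Contour.tendsto_iteratedDeriv_integral_exp_mul (hI : IsOpen I) (hb : c.PhaseBound N I M)
    {k : ℕ} (hg : ∀ m ≤ k, c.Converges fun z => g z * N z ^ m) :
    Tendsto (fun x : ℝ => (-Complex.I) ^ k * iteratedDeriv k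
      (fun x : ℝ => c.integral fun z => Complex.exp (Complex.I * N z * x) * g z) x)
      (𝓝[I] 0) (𝓝 (c.integral fun z => g z * N z ^ k)) := by
  refine (Contour.tendsto_integral_exp_mul hb (hg k le_rfl)).congr' ?_
  filter_upwards [self_mem_nhdsWithin] with x hx
  rw [Contour.iteratedDeriv_integral_exp_mul hI hb hg hx, ← mul_assoc, ← mul_pow]
  simp

/-! ### The cube root of unity and the phase on `S ∪ s` -/

theorem alpha_eq_exp : alpha = Complex.exp ((2 * π / 3 : ℝ) * Complex.I) := by
  rw [alpha]; congr 1; push_cast; ring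

theorem neg_alpha_eq_exp : -alpha = Complex.exp (-(π / 3) * Complex.I) := by
  rw [alpha, neg_eq_neg_one_mul, ← Complex.exp_pi_mul_I, ← Complex.exp_add,
    Complex.exp_eq_exp_iff_exists_int]
  exact ⟨1, by push_cast; ring⟩

theorem alpha_sq_eq_exp : alpha ^ 2 = Complex.exp (-(2 * π / 3) * Complex.I) := by
  rw [alpha, ← Complex.exp_nat_mul, Complex.exp_eq_exp_iff_exists_int]
  exact ⟨1, by push_cast; ring⟩

theorem norm_alpha : ‖alpha‖ = 1 := by
  rw [alpha_eq_exp, Complex.norm_exp_ofReal_mul_I]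

theorem alpha_pow_three : alpha ^ 3 = 1 := by
  rw [alpha, ← Complex.exp_nat_mul, ← Complex.exp_two_pi_mul_I]
  congr 1; push_cast; ring

theorem cos_two_pi_div_three : Real.cos (2 * π / 3) = -(1 / 2) := by
  rw [show 2 * π / 3 = π - π / 3 by ring, Real.cos_pi_sub, Real.cos_pi_div_three]

theorem sin_two_pi_div_three : Real.sin (2 * π / 3) = √3 / 2 := by
  rw [show 2 * π / 3 = π - π / 3 by ring, Real.sin_pi_sub, Real.sin_pi_div_three]

theorem alpha_re : alpha.re = -(1 / 2) := by
  rw [alpha_eq_exp, Complex.exp_ofReal_mul_I_re, cos_two_pi_div_three]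

theorem alpha_im : alpha.im = √3 / 2 := by
  rw [alpha_eq_exp, Complex.exp_ofReal_mul_I_im, sin_two_pi_div_three]

theorem alpha_sq_re : (alpha ^ 2).re = -(1 / 2) := by
  have h3 : √3 ^ 2 = 3 := Real.sq_sqrt (by norm_num)
  rw [sq, Complex.mul_re, alpha_re, alpha_im]
  linear_combination (-1 / 4) * h3

theorem alpha_sq_im : (alpha ^ 2).im = -(√3 / 2) := by
  rw [sq, Complex.mul_im, alpha_re, alpha_im]; ring

/-- By `tendsto_nu` the difference tends to `0` at infinity. What remains is a compact annulus, on
which `ν` is continuous because all branch points lie strictly inside `|z| = R`. -/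
theorem exists_norm_nu_sub_le (a : ℝ) {R : ℝ} (hRa : 4 * |a| ^ 3 < 27 * R ^ 6) (hR : 0 < R) :
    ∃ M, 0 ≤ M ∧ ∀ z : ℂ, R ≤ ‖z‖ → ‖nu a z - z‖ ≤ M := by
  have h0 : Tendsto (fun z => nu a z - z) (cobounded ℂ) (𝓝 0) := by
    have h := (tendsto_inv₀_cobounded (α := ℂ)).mul (tendsto_nu a)
    rw [zero_mul] at h
    refine h.congr' ?_
    filter_upwards [eventually_ne_cobounded (0 : ℂ)] with z hz
    field_simp
  have h1 : ∀ᶠ z in cobounded ℂ, ‖nu a z - z‖ ≤ 1 := by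
    exact h0.norm.eventually_le_const (by simp)
  rw [(Metric.hasBasis_cobounded_compl_closedBall (0 : ℂ)).eventually_iff] at h1
  obtain ⟨r, -, hr⟩ := h1
  have hK : IsCompact (Metric.closedBall (0 : ℂ) r ∩ {z | R ≤ ‖z‖}) :=
    (isCompact_closedBall 0 r).inter_right (isClosed_le continuous_const continuous_norm)
  have hc : ContinuousOn (fun z => nu a z - z) (Metric.closedBall (0 : ℂ) r ∩ {z | R ≤ ‖z‖}) := by
    intro z hz
    have hz2 : R ≤ ‖z‖ := hz.2
    have : 4 * |a| ^ 3 < 27 * ‖z‖ ^ 6 := hRa.trans_le (by gcongr)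
    exact ((differentiableAt_nu a this).continuousAt.sub continuousAt_id).continuousWithinAt
  obtain ⟨B, hB⟩ := hK.exists_bound_of_continuousOn hc
  refine ⟨max B 1, le_max_of_le_right zero_le_one, fun z hz => ?_⟩
  by_cases hzr : z ∈ Metric.closedBall (0 : ℂ) r
  · exact (hB z ⟨hzr, hz⟩).trans (le_max_left _ _)
  · exact (hr hzr).trans (le_max_right _ _)

/-- The properties of a phase function `N` that make `exp(i N x)` of at most bounded size, for
`x ∈ I` bounded, on the sets across which the contours are deformed. -/
structure Phase (N : ℂ → ℂ) (I : Set ℝ) (R ε δ : ℝ) : Prop where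
  diff : ∀ z, R ≤ ‖z‖ → DifferentiableAt ℂ N z
  growth : ∃ B, 0 ≤ B ∧ ∀ z, R ≤ ‖z‖ → ‖N z‖ ≤ B * ‖z‖
  im : ∃ M, 0 ≤ M ∧ ∀ x ∈ I, ∀ z ∈ stripS R ε ∪ sectorS R δ, -(M * |x|) ≤ x * (N z).im

theorem Phase.continuousOn {N : ℂ → ℂ} {I : Set ℝ} {R ε δ : ℝ} (h : Phase N I R ε δ) :
    ContinuousOn N {z | R ≤ ‖z‖} :=
  fun z hz => (h.diff z hz).continuousAt.continuousWithinAt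

theorem abs_le_norm_ofReal_add_mul_I (r y : ℝ) : |r| ≤ ‖(r + y * Complex.I : ℂ)‖ := by
  simpa using Complex.abs_re_le_norm (r + y * Complex.I : ℂ)

theorem le_norm_of_mem {R ε δ : ℝ} (hR : 0 < R) {z : ℂ} (hz : z ∈ stripS R ε ∪ sectorS R δ) :
    R ≤ ‖z‖ := by
  have hexp : ∀ μ : ℝ, ‖Complex.exp (Complex.I * μ)‖ = 1 := fun μ => by
    rw [mul_comm, Complex.norm_exp_ofReal_mul_I]
  rcases hz with (⟨u, y, hu, -, -, rfl | rfl⟩ | ⟨μ, -, -, rfl⟩) |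
    (⟨r, μ, hr, -, rfl⟩ | ⟨μ, -, -, rfl⟩)
  · rw [norm_mul, norm_pow, norm_alpha, one_pow, one_mul]
    have := Complex.abs_re_le_norm (u - Complex.I * y : ℂ)
    simp only [Complex.sub_re, Complex.ofReal_re, Complex.re_mul_ofReal, Complex.I_re, zero_mul,
      sub_zero] at this
    exact hu.trans ((le_abs_self u).trans this)
  · rw [norm_mul, norm_alpha, one_mul]
    have := Complex.abs_re_le_norm (-u - Complex.I * y : ℂ)
    simp only [Complex.sub_re, Complex.neg_re, Complex.ofReal_re, Complex.re_mul_ofReal,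
      Complex.I_re, zero_mul, sub_zero, abs_neg] at this
    exact hu.trans ((le_abs_self u).trans this)
  · simp [hexp, abs_of_pos hR]
  · simp only [norm_mul, hexp, mul_one, Complex.norm_real, Real.norm_eq_abs]
    exact hr.trans (le_abs_self r)
  · simp [hexp, abs_of_pos hR]

theorem exists_polar_of_mem_sectorS {R δ : ℝ} (hR : 0 < R) (hδ' : δ < π / 6) {z : ℂ}
    (hz : z ∈ sectorS R δ) :
    ∃ r μ : ℝ, 0 ≤ r ∧ -(2 * π / 3) ≤ μ ∧ μ ≤ -(π / 3) ∧ z = r * Complex.exp (Complex.I * μ) := by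
  rcases hz with ⟨r, μ, hr, hμ, rfl⟩ | ⟨μ, h1, h2, rfl⟩
  · refine ⟨r, μ, hR.le.trans hr, ?_, ?_, rfl⟩ <;> rcases hμ with ⟨h1, h2⟩ | ⟨h1, h2⟩ <;> linarith
  · exact ⟨R, μ, hR.le, h1, h2, rfl⟩

theorem im_alpha_pow_mul_polar (j : ℕ) (r μ : ℝ) :
    (alpha ^ j * (r * Complex.exp (Complex.I * μ))).im = r * Real.sin (μ + j * (2 * π / 3)) := by
  have : alpha ^ j * (r * Complex.exp (Complex.I * μ)) =
      r * Complex.exp ((μ + j * (2 * π / 3) : ℝ) * Complex.I) := by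
    rw [alpha_eq_exp, ← Complex.exp_nat_mul, mul_left_comm, ← Complex.exp_add]
    congr 2; push_cast; ring
  rw [this, Complex.im_ofReal_mul, Complex.exp_ofReal_mul_I_im]

/-- For arguments in `[-2π/3, -π/3]`, multiplication by `α` or `α²` turns `z` into the closed upper
half-plane, while `z` itself lies in the lower one. This covers `s` and the arc. In the strips of
`S` the base rays obey the same inequalities, and a displacement by `y ≤ ε` costs at most `ε`. -/
theorem le_im_alpha_mul {R ε δ : ℝ} (hR : 0 < R) (hε : 0 < ε) (hδ' : δ < π / 6) {z : ℂ}
    (hz : z ∈ stripS R ε ∪ sectorS R δ) :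
    -ε ≤ (alpha ^ 1 * z).im ∧ -ε ≤ (alpha ^ 2 * z).im ∧ z.im ≤ ε := by
  have hpol : ∀ r μ : ℝ, 0 ≤ r → -(2 * π / 3) ≤ μ → μ ≤ -(π / 3) →
      -ε ≤ (alpha ^ 1 * (r * Complex.exp (Complex.I * μ))).im ∧
      -ε ≤ (alpha ^ 2 * (r * Complex.exp (Complex.I * μ))).im ∧
      (r * Complex.exp (Complex.I * μ)).im ≤ ε := by
    intro r μ hr h1 h2
    have h0 := im_alpha_pow_mul_polar 0 r μ
    rw [pow_zero, one_mul] at h0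
    rw [im_alpha_pow_mul_polar, im_alpha_pow_mul_polar, h0]
    have hπ := Real.pi_pos
    refine ⟨?_, ?_, ?_⟩
    · have := mul_nonneg hr (Real.sin_nonneg_of_nonneg_of_le_pi
        (x := μ + (1 : ℕ) * (2 * π / 3)) (by push_cast; linarith) (by push_cast; linarith))
      linarith
    · have := mul_nonneg hr (Real.sin_nonneg_of_nonneg_of_le_pi
        (x := μ + (2 : ℕ) * (2 * π / 3)) (by push_cast; linarith) (by push_cast; linarith))
      linarith
    · have := mul_nonpos_of_nonneg_of_nonpos hr (Real.sin_nonpos_of_nonpos_of_neg_pi_le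
        (x := μ + (0 : ℕ) * (2 * π / 3)) (by push_cast; linarith) (by push_cast; linarith))
      linarith
  rcases hz with (⟨u, y, hu, hy, hyε, h⟩ | ⟨μ, h1, h2, rfl⟩) | hz
  · have h3 : 0 ≤ √3 * u := mul_nonneg (Real.sqrt_nonneg 3) (hR.le.trans hu)
    have hα3 : alpha * alpha ^ 2 = 1 := by rw [← alpha_pow_three]; ring
    have hα4 : alpha ^ 2 * alpha ^ 2 = alpha := by
      rw [show alpha ^ 2 * alpha ^ 2 = alpha ^ 3 * alpha by ring, alpha_pow_three, one_mul]
    rw [pow_one]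
    rcases h with rfl | rfl
    · rw [← mul_assoc, ← mul_assoc, hα3, hα4]
      simp only [Complex.mul_im, alpha_re, alpha_im, alpha_sq_re, alpha_sq_im, Complex.one_re,
        Complex.one_im, Complex.sub_re, Complex.sub_im, Complex.ofReal_re, Complex.ofReal_im,
        Complex.I_re, Complex.I_im, Complex.mul_re]
      refine ⟨?_, ?_, ?_⟩ <;> nlinarith
    · rw [← mul_assoc, ← mul_assoc, mul_comm (alpha ^ 2), hα3, ← sq]
      simp only [Complex.mul_im, alpha_re, alpha_im, alpha_sq_re, alpha_sq_im, Complex.one_re,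
        Complex.one_im, Complex.sub_re, Complex.sub_im, Complex.ofReal_re, Complex.ofReal_im,
        Complex.I_re, Complex.I_im, Complex.mul_re, Complex.neg_re, Complex.neg_im]
      refine ⟨?_, ?_, ?_⟩ <;> nlinarith
  · exact hpol R μ hR.le h1 h2
  · obtain ⟨r, μ, hr, h1, h2, rfl⟩ := exists_polar_of_mem_sectorS hR hδ' hz
    exact hpol r μ hr h1 h2

/-- Everything transfers from `α^j z` to `ν(α^j z)` because their difference is bounded by some `M`:
the constant in the half-plane bound grows by `M`, and `M ≤ (M / R) ‖z‖` gives linear growth. -/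
theorem phase_nu {a R ε δ : ℝ} (hR : 0 < R) (hRa : 4 * |a| ^ 3 < 27 * R ^ 6) {j : ℕ} {I : Set ℝ}
    {c : ℝ} (hc : 0 ≤ c)
    (him : ∀ x ∈ I, ∀ z ∈ stripS R ε ∪ sectorS R δ, -(c * |x|) ≤ x * (alpha ^ j * z).im) :
    Phase (fun z => nu a (alpha ^ j * z)) I R ε δ := by
  obtain ⟨M, hM, hb⟩ := exists_norm_nu_sub_le a hRa hR
  have hn : ∀ z, ‖alpha ^ j * z‖ = ‖z‖ := fun z => by
    rw [norm_mul, norm_pow, norm_alpha, one_pow, one_mul]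
  refine ⟨fun z hz => ?_, ⟨1 + M / R, by positivity, fun z hz => ?_⟩,
    ⟨c + M, by positivity, fun x hx z hz => ?_⟩⟩
  · have : 4 * |a| ^ 3 < 27 * ‖alpha ^ j * z‖ ^ 6 := by
      rw [hn]; exact hRa.trans_le (by gcongr)
    exact (differentiableAt_nu a this).comp z (differentiableAt_id.const_mul _)
  · have h1 := hb (alpha ^ j * z) (by rwa [hn])
    have h2 := norm_add_le (nu a (alpha ^ j * z) - alpha ^ j * z) (alpha ^ j * z)
    rw [sub_add_cancel, hn] at h2
    have h3 : M ≤ M / R * ‖z‖ := by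
      rw [div_mul_eq_mul_div, le_div_iff₀ hR]; gcongr
    linarith
  · have hzR := le_norm_of_mem hR hz
    have h1 := hb (alpha ^ j * z) (by rwa [hn])
    have h2 := (Complex.abs_im_le_norm _).trans h1
    rw [Complex.sub_im] at h2
    have h3 := him x hx z hz
    have h4 : |x * ((nu a (alpha ^ j * z)).im - (alpha ^ j * z).im)| ≤ |x| * M := by
      rw [abs_mul]; gcongr
    have h5 := neg_le_of_abs_le h4
    linarith

theorem phase_nu_pos {a R ε δ : ℝ} (hR : 0 < R) (hRa : 4 * |a| ^ 3 < 27 * R ^ 6) (hε : 0 < ε)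
    (hδ' : δ < π / 6) {j : ℕ} (hj : j ∈ ({1, 2} : Set ℕ)) :
    Phase (fun z => nu a (alpha ^ j * z)) (Ioi 0) R ε δ := by
  refine phase_nu hR hRa hε.le fun x hx z hz => ?_
  rw [abs_of_pos hx]
  have := le_im_alpha_mul hR hε hδ' hz
  rcases hj with rfl | rfl
  · linarith [mul_le_mul_of_nonneg_left this.1 (le_of_lt hx)]
  · linarith [mul_le_mul_of_nonneg_left this.2.1 (le_of_lt hx)]

theorem phase_nu_neg {a R ε δ : ℝ} (hR : 0 < R) (hRa : 4 * |a| ^ 3 < 27 * R ^ 6) (hε : 0 < ε)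
    (hδ' : δ < π / 6) : Phase (fun z => nu a (alpha ^ 0 * z)) (Iio 0) R ε δ := by
  refine phase_nu hR hRa hε.le fun x hx z hz => ?_
  rw [abs_of_neg hx, pow_zero, one_mul]
  linarith [mul_le_mul_of_nonpos_left (le_im_alpha_mul hR hε hδ' hz).2.2 (le_of_lt hx)]

/-! ### Closing pieces vanish as the truncation recedes -/

/-- The bound does not depend on `h`. Both signs of `h` occur, since the two rays of `∂D` rotate in
opposite directions. -/
theorem abs_integral_exp_neg_mul_abs_le {k : ℝ} (hk : 0 < k) (h : ℝ) :
    |∫ μ in (0 : ℝ)..h, Real.exp (-(k * |μ|))| ≤ 1 / k := by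
  have hpos : ∀ h : ℝ, 0 ≤ h → |∫ μ in (0 : ℝ)..h, Real.exp (-(k * |μ|))| ≤ 1 / k := by
    intro h hh
    have h1 : ∫ μ in (0 : ℝ)..h, Real.exp (-(k * |μ|)) = (1 - Real.exp (-(k * h))) / k := by
      have h2 : ∀ μ ∈ uIcc 0 h,
          HasDerivAt (fun μ => -Real.exp (-(k * μ)) / k) (Real.exp (-(k * μ))) μ := by
        intro μ _
        have h3 : HasDerivAt (fun μ => -(k * μ)) (-(k * 1)) μ :=
          ((hasDerivAt_id μ).const_mul k).neg
        refine (h3.exp.neg.div_const k).congr_deriv ?_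
        field_simp
      have h4 : ∫ μ in (0 : ℝ)..h, Real.exp (-(k * |μ|)) =
          ∫ μ in (0 : ℝ)..h, Real.exp (-(k * μ)) := by
        refine intervalIntegral.integral_congr fun μ hμ => ?_
        rw [uIcc_of_le hh] at hμ
        simp only [abs_of_nonneg hμ.1]
      rw [h4, intervalIntegral.integral_eq_sub_of_hasDerivAt h2
        ((by fun_prop : Continuous fun μ => Real.exp (-(k * μ))).intervalIntegrable _ _)]
      simp only [mul_zero, neg_zero, Real.exp_zero]
      ring
    have h5 : Real.exp (-(k * h)) ≤ 1 := Real.exp_le_one_iff.2 (by nlinarith)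
    rw [h1, abs_of_nonneg (div_nonneg (by linarith) hk.le)]
    gcongr
    linarith [Real.exp_pos (-(k * h))]
  rcases le_total 0 h with hh | hh
  · exact hpos h hh
  · have h1 := intervalIntegral.integral_comp_neg (a := 0) (b := h)
      (fun μ => Real.exp (-(k * |μ|)))
    simp only [abs_neg, neg_zero] at h1
    rw [h1, intervalIntegral.integral_symm, abs_neg]
    exact hpos (-h) (by linarith)

/-- The closing segment has the fixed length `|h|`, so uniform smallness of `F` on it is enough. -/
theorem tendsto_integral_ray_shift {F : ℂ → ℂ} {K : Set ℂ} {β : ℂ} (hβ : ‖β‖ = 1) {R h : ℝ}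
    (hK : ∀ r y : ℝ, R ≤ r → y ∈ uIcc 0 h → β * (r + y * Complex.I) ∈ K)
    (hc : ContinuousOn F K) (hd : DifferentiableOn ℂ F (interior K))
    (hint : IntegrableOn (fun r : ℝ => F (β * (r + h * Complex.I))) (Ici R))
    (hclose : ∀ η > 0, ∀ᶠ C : ℝ in atTop, ∀ y ∈ uIcc 0 h, ‖F (β * (C + y * Complex.I))‖ ≤ η) :
    Tendsto (fun C => ∫ r in R..C, F (β * r) * β) atTop
      (𝓝 ((∫ y in (0 : ℝ)..h, F (β * (R + y * Complex.I)) * (β * Complex.I))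
        + ∫ r in Ici R, F (β * (r + h * Complex.I)) * β)) := by
  have hβ0 : β ≠ 0 := norm_ne_zero_iff.1 (by rw [hβ]; exact one_ne_zero)
  have h1 : Tendsto (fun C => ∫ r in R..C, F (β * (r + h * Complex.I)) * β) atTop
      (𝓝 (∫ r in Ici R, F (β * (r + h * Complex.I)) * β)) := by
    rw [integral_Ici_eq_integral_Ioi]
    exact intervalIntegral_tendsto_integral_Ioi R
      ((hint.mono_set Ioi_subset_Ici_self).mul_const β) tendsto_id
  have h2 : Tendsto (fun C : ℝ => ∫ y in (0 : ℝ)..h, F (β * (C + y * Complex.I)) *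
      (β * Complex.I)) atTop (𝓝 0) := by
    rw [Metric.tendsto_nhds]
    intro e he
    filter_upwards [hclose (e / (2 * (|h| + 1))) (by positivity)] with C hC
    rw [dist_zero_right]
    refine (intervalIntegral.norm_integral_le_of_norm_le_const fun y hy => ?_).trans_lt
      (?_ : e / (2 * (|h| + 1)) * |h - 0| < e)
    · rw [norm_mul, norm_mul, hβ, Complex.norm_I, mul_one, mul_one]
      exact hC y (uIoc_subset_uIcc hy)
    · rw [sub_zero, div_mul_eq_mul_div, div_lt_iff₀ (by positivity)]
      nlinarith [abs_nonneg h]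
  have h3 := (tendsto_const_nhds (x := ∫ y in (0 : ℝ)..h, F (β * (R + y * Complex.I)) *
    (β * Complex.I))).add (h1.sub h2)
  rw [sub_zero] at h3
  refine h3.congr' ?_
  filter_upwards [eventually_ge_atTop R] with C hC
  rw [integral_ray_eq_shift hβ0 hC hK hc hd]
  ring

/-- A variant of Jordan's lemma. The closing arc has length `C |h|`, so smallness of `F` alone would
not do; the factor `e^{-b C³ |μ|}` integrates to at most `1 / (b C³)`, which beats `C`. -/
theorem tendsto_integral_ray_rotate {F : ℂ → ℂ} {K : Set ℂ} {β : ℂ} (hβ : ‖β‖ = 1) {R h b : ℝ}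
    (hR : 0 < R) (hb : 0 < b)
    (hK : ∀ r μ : ℝ, R ≤ r → μ ∈ uIcc 0 h → β * (r * Complex.exp (μ * Complex.I)) ∈ K)
    (hc : ContinuousOn F K) (hd : DifferentiableOn ℂ F (interior K))
    (hint : IntegrableOn (fun r : ℝ => F (β * Complex.exp (h * Complex.I) * r)) (Ici R))
    (hclose : ∀ η > 0, ∀ᶠ C : ℝ in atTop, ∀ μ ∈ uIcc 0 h,
      ‖F (β * (C * Complex.exp (μ * Complex.I)))‖ ≤ η * Real.exp (-(b * C ^ 3 * |μ|))) :
    Tendsto (fun C => ∫ r in R..C, F (β * r) * β) atTop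
      (𝓝 ((∫ μ in (0 : ℝ)..h, F (β * (R * Complex.exp (μ * Complex.I))) *
          (β * (R * Complex.exp (μ * Complex.I)) * Complex.I))
        + ∫ r in Ici R, F (β * Complex.exp (h * Complex.I) * r) *
          (β * Complex.exp (h * Complex.I)))) := by
  have hβ0 : β ≠ 0 := norm_ne_zero_iff.1 (by rw [hβ]; exact one_ne_zero)
  have h1 : Tendsto (fun C => ∫ r in R..C, F (β * Complex.exp (h * Complex.I) * r) *
      (β * Complex.exp (h * Complex.I))) atTop
      (𝓝 (∫ r in Ici R, F (β * Complex.exp (h * Complex.I) * r) *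
        (β * Complex.exp (h * Complex.I)))) := by
    rw [integral_Ici_eq_integral_Ioi]
    exact intervalIntegral_tendsto_integral_Ioi R
      ((hint.mono_set Ioi_subset_Ici_self).mul_const _) tendsto_id
  have h2 : Tendsto (fun C : ℝ => ∫ μ in (0 : ℝ)..h, F (β * (C * Complex.exp (μ * Complex.I))) *
        (β * (C * Complex.exp (μ * Complex.I)) * Complex.I)) atTop (𝓝 0) := by
    rw [Metric.tendsto_nhds]
    intro e he
    -- With this constant the arc contributes at most `(e b / 2) C / (b C³) = e / (2 C²)`, which is
    -- less than `e` once `C ≥ 1`.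
    filter_upwards [hclose (e * b / 2) (by positivity), eventually_ge_atTop 1] with C hC hC1
    have hC0 : 0 < C := one_pos.trans_le hC1
    rw [dist_zero_right]
    have h3 : ‖∫ μ in (0 : ℝ)..h, F (β * (C * Complex.exp (μ * Complex.I))) *
        (β * (C * Complex.exp (μ * Complex.I)) * Complex.I)‖ ≤
        |∫ μ in (0 : ℝ)..h, e * b / 2 * C * Real.exp (-(b * C ^ 3 * |μ|))| := by
      refine intervalIntegral.norm_integral_le_abs_of_norm_le (ae_restrict_of_forall_mem
        measurableSet_uIoc fun μ hμ => ?_) (Continuous.intervalIntegrable (by fun_prop) _ _)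
      rw [norm_mul, norm_mul, norm_mul, norm_mul, hβ, Complex.norm_I,
        Complex.norm_exp_ofReal_mul_I, Complex.norm_real, Real.norm_eq_abs, abs_of_pos hC0]
      nlinarith [mul_le_mul_of_nonneg_right (hC μ (uIoc_subset_uIcc hμ)) hC0.le]
    refine h3.trans_lt ?_
    rw [intervalIntegral.integral_const_mul, abs_mul, abs_of_pos (by positivity)]
    have h4 := abs_integral_exp_neg_mul_abs_le (k := b * C ^ 3) (by positivity) h
    refine (mul_le_mul_of_nonneg_left h4 (by positivity)).trans_lt ?_
    rw [mul_one_div, div_lt_iff₀ (by positivity)]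
    have h5 : C ≤ C ^ 3 := le_self_pow₀ hC1 (by norm_num)
    have h6 : 0 < e * b := by positivity
    nlinarith [mul_le_mul_of_nonneg_left h5 h6.le, mul_pos h6 hC0]
  have h3 := (tendsto_const_nhds (x := ∫ μ in (0 : ℝ)..h,
    F (β * (R * Complex.exp (μ * Complex.I))) *
      (β * (R * Complex.exp (μ * Complex.I)) * Complex.I))).add (h1.sub h2)
  rw [sub_zero] at h3
  refine h3.congr' ?_
  filter_upwards [eventually_ge_atTop R] with C hC
  rw [integral_ray_eq_rotate hβ0 hR hC hK hc hd]
  ring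

/-- Serves both deformations: a shift produces exactly `r²` in the exponent, and the `r³` of a
rotation may be weakened to `r²`. -/
theorem integrableOn_Ici_of_gaussian_decay {f : ℝ → ℂ} {R A b : ℝ} {m : ℕ} (hb : 0 < b)
    (hf : ContinuousOn f (Ici R))
    (h : ∀ᶠ r in atTop, ‖f r‖ ≤ A * (r ^ m * Real.exp (-(b * r ^ 2)))) :
    IntegrableOn f (Ici R) := by
  have hg : Integrable (fun r : ℝ => r ^ m * Real.exp (-(b * r ^ 2))) := by
    have := integrable_rpow_mul_exp_neg_mul_sq hb (s := m)
      (by have := m.cast_nonneg (α := ℝ); linarith)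
    simpa only [Real.rpow_natCast, neg_mul] using this
  refine (hf.locallyIntegrableOn measurableSet_Ici).integrableOn_of_isBigO_atTop
    (g := fun r : ℝ => r ^ m * Real.exp (-(b * r ^ 2))) ?_ (hg.integrableAtFilter _)
  refine IsBigO.of_bound A ?_
  filter_upwards [h, eventually_ge_atTop 0] with r hr h0
  rwa [Real.norm_of_nonneg (by positivity)]

/-! ### The rays of `∂D` and the sign of `Im z³` beside them -/

/-- The direction `β` of a ray of `∂D`, with `β³ = κ = ± 1`, from which the set `s` lies in the
direction of the angle `κ δ` and the set `S` in the direction of `- i κ β`. -/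
structure Ray (R ε δ κ : ℝ) (β : ℂ) : Prop where
  kappa : κ = 1 ∨ κ = -1
  norm : ‖β‖ = 1
  cube : β ^ 3 = κ
  strip : ∀ r y : ℝ, R ≤ r → y ∈ uIcc 0 (-(κ * ε)) → β * (r + y * Complex.I) ∈ stripS R ε
  sector : ∀ r μ : ℝ, R ≤ r → μ ∈ uIcc 0 (κ * δ) →
    β * (r * Complex.exp (μ * Complex.I)) ∈ sectorS R δ

theorem ray_out {R ε δ : ℝ} (hε : 0 < ε) (hδ : 0 < δ) : Ray R ε δ 1 (alpha ^ 2) := by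
  refine ⟨.inl rfl, by rw [norm_pow, norm_alpha, one_pow], ?_, fun r y hr hy => ?_,
    fun r μ hr hμ => ?_⟩
  · rw [← pow_mul, mul_comm, pow_mul, alpha_pow_three]; simp
  · rw [one_mul, uIcc_of_ge (by linarith)] at hy
    refine .inl ⟨r, -y, hr, by linarith [hy.2], by linarith [hy.1], .inl ?_⟩
    push_cast; ring
  · rw [one_mul, uIcc_of_le hδ.le] at hμ
    refine .inl ⟨r, μ - 2 * π / 3, hr, .inl ⟨by linarith [hμ.1], by linarith [hμ.2]⟩, ?_⟩
    rw [alpha_sq_eq_exp, mul_left_comm, ← Complex.exp_add]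
    congr 2; push_cast; ring

/-- The direction is `-α` rather than `α`, so that this ray too is parametrized outwards from `R`;
its inward orientation reappears as the minus sign in `integral_bdryD`. -/
theorem ray_in {R ε δ : ℝ} (hε : 0 < ε) (hδ : 0 < δ) : Ray R ε δ (-1) (-alpha) := by
  refine ⟨.inr rfl, by rw [norm_neg, norm_alpha], ?_, fun r y hr hy => ?_, fun r μ hr hμ => ?_⟩
  · rw [neg_pow, alpha_pow_three]; norm_num
  · rw [neg_one_mul, neg_neg, uIcc_of_le hε.le] at hy
    refine .inl ⟨r, y, hr, hy.1, hy.2, .inr ?_⟩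
    ring
  · rw [neg_one_mul, uIcc_of_ge (by linarith)] at hμ
    refine .inl ⟨r, μ - π / 3, hr, .inr ⟨by linarith [hμ.1], by linarith [hμ.2]⟩, ?_⟩
    rw [neg_alpha_eq_exp, mul_left_comm, ← Complex.exp_add]
    congr 2; push_cast; ring

theorem norm_exp_neg_I_mul (z : ℂ) (s : ℝ) :
    ‖Complex.exp (-(Complex.I * z ^ 3 * s))‖ = Real.exp (s * (z ^ 3).im) := by
  rw [Complex.norm_exp]; congr 1; simp; ring

namespace Ray
variable {R ε δ κ : ℝ} {β : ℂ}

/-- Since `β³ = κ`, the imaginary part is `κ y (3r² - y²)`. The direction of the shift gives `κ y =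
-|y|`, and `|y| ≤ ε ≤ r` leaves at least `2r²` in the bracket. -/
theorem im_cube_shift_le (h : Ray R ε δ κ β) (hε : 0 < ε) {r y : ℝ} (hr : ε ≤ r)
    (hy : y ∈ uIcc 0 (-(κ * ε))) :
    ((β * (r + y * Complex.I)) ^ 3).im ≤ -(2 * |y| * r ^ 2) := by
  have h1 : ((β * (r + y * Complex.I)) ^ 3).im = κ * y * (3 * r ^ 2 - y ^ 2) := by
    rw [mul_pow, h.cube, Complex.im_ofReal_mul]
    have : ((r : ℂ) + y * Complex.I) ^ 3 =
        ((r ^ 3 - 3 * r * y ^ 2 : ℝ) : ℂ) + ((3 * r ^ 2 * y - y ^ 3 : ℝ) : ℂ) * Complex.I := by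
      push_cast
      linear_combination (3 * r * y ^ 2 + y ^ 3 * Complex.I : ℂ) * Complex.I_sq
    rw [this]
    simp only [Complex.add_im, Complex.ofReal_im, Complex.mul_im, Complex.ofReal_re,
      Complex.I_re, Complex.I_im]
    ring
  have h2 : κ * y = -|y| ∧ |y| ≤ ε := by
    rcases h.kappa with rfl | rfl
    · rw [one_mul, uIcc_of_ge (by linarith)] at hy
      rw [abs_of_nonpos hy.2]
      constructor <;> linarith [hy.1]
    · rw [neg_one_mul, neg_neg, uIcc_of_le hε.le] at hy
      rw [abs_of_nonneg hy.1]
      constructor <;> linarith [hy.2]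
  have h3 : y ^ 2 ≤ r ^ 2 := by
    rw [← sq_abs y]
    exact pow_le_pow_left₀ (abs_nonneg y) (h2.2.trans hr) 2
  rw [h1, h2.1]
  nlinarith [mul_le_mul_of_nonneg_left h3 (abs_nonneg y)]

/-- The imaginary part is `r³ sin(3|μ|)`, and Jordan's inequality `sin v ≥ 2v/π` on `[0, π/2]`
applies because `3|μ| ≤ 3δ < π/2`. This is where the restriction `δ < π/6` comes from. -/
theorem le_im_cube_rotate (h : Ray R ε δ κ β) (hδ : 0 < δ) (hδ' : δ < π / 6) {r μ : ℝ}
    (hr : 0 ≤ r) (hμ : μ ∈ uIcc 0 (κ * δ)) :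
    6 / π * |μ| * r ^ 3 ≤ ((β * (r * Complex.exp (μ * Complex.I))) ^ 3).im := by
  have h1 : ((β * (r * Complex.exp (μ * Complex.I))) ^ 3).im = κ * (r ^ 3 * Real.sin (3 * μ)) := by
    rw [mul_pow, h.cube, Complex.im_ofReal_mul, mul_pow, ← Complex.exp_nat_mul,
      ← Complex.ofReal_pow, Complex.im_ofReal_mul,
      show ((3 : ℕ) : ℂ) * (μ * Complex.I) = ((3 * μ : ℝ) : ℂ) * Complex.I by push_cast; ring,
      Complex.exp_ofReal_mul_I_im]
  have h2 : κ * Real.sin (3 * μ) = Real.sin (3 * |μ|) ∧ |μ| ≤ δ := by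
    rcases h.kappa with rfl | rfl
    · rw [one_mul, uIcc_of_le hδ.le] at hμ
      rw [abs_of_nonneg hμ.1]
      exact ⟨one_mul _, hμ.2⟩
    · rw [neg_one_mul, uIcc_of_ge (by linarith)] at hμ
      rw [abs_of_nonpos hμ.2]
      refine ⟨?_, by linarith [hμ.1]⟩
      rw [mul_neg, Real.sin_neg, neg_one_mul]
  have h3 := Real.mul_le_sin (x := 3 * |μ|) (by positivity) (by linarith [h2.2])
  have h4 := mul_le_mul_of_nonneg_right h3 (pow_nonneg hr 3)
  rw [h1, mul_left_comm, h2.1]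
  calc 6 / π * |μ| * r ^ 3 = 2 / π * (3 * |μ|) * r ^ 3 := by ring
    _ ≤ _ := by rw [mul_comm (r ^ 3)]; exact h4

end Ray

/-! ### Amplitudes `e^{-i z³ s} φ` and their deformation along one ray -/

theorem exists_norm_le_of_tendsto_cobounded {φ : ℂ → ℂ} {K : Set ℂ}
    (hlim : Tendsto φ (cobounded ℂ ⊓ 𝓟 K) (𝓝 0)) {η : ℝ} (hη : 0 < η) :
    ∃ r : ℝ, ∀ z ∈ K, r < ‖z‖ → ‖φ z‖ ≤ η := by
  have h1 : ∀ᶠ z in cobounded ℂ ⊓ 𝓟 K, ‖φ z‖ ≤ η := hlim.norm.eventually_le_const (by simpa)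
  rw [eventually_inf_principal,
    (Metric.hasBasis_cobounded_compl_closedBall (0 : ℂ)).eventually_iff] at h1
  obtain ⟨r, -, hr⟩ := h1
  exact ⟨r, fun z hz hrz => hr (by simpa using hrz) hz⟩

/-- The amplitude `e^{-i z³ s} φ(z)`. -/
noncomputable def amp (s : ℝ) (φ : ℂ → ℂ) (z : ℂ) : ℂ :=
  Complex.exp (-(Complex.I * z ^ 3 * s)) * φ z

theorem norm_amp (s : ℝ) (φ : ℂ → ℂ) (z : ℂ) :
    ‖amp s φ z‖ = Real.exp (s * (z ^ 3).im) * ‖φ z‖ := by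
  rw [amp, norm_mul, norm_exp_neg_I_mul]

theorem continuousOn_amp {s : ℝ} {φ : ℂ → ℂ} {K : Set ℂ} (h : ContinuousOn φ K) :
    ContinuousOn (amp s φ) K :=
  ContinuousOn.mul (by fun_prop) h

theorem differentiableOn_amp {s : ℝ} {φ : ℂ → ℂ} {K : Set ℂ} (h : DifferentiableOn ℂ φ K) :
    DifferentiableOn ℂ (amp s φ) K :=
  DifferentiableOn.mul (by fun_prop) h

namespace Phase
variable {N φ : ℂ → ℂ} {I : Set ℝ} {R ε δ s : ℝ} {K : Set ℂ}

theorem continuousOn_exp_mul_amp (hN : Phase N I R ε δ) (hK : ∀ z ∈ K, R ≤ ‖z‖)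
    (hφ : ContinuousOn φ K) (x : ℝ) :
    ContinuousOn (fun z => Complex.exp (Complex.I * N z * x) * amp s φ z) K := by
  have h1 : ContinuousOn N K := hN.continuousOn.mono hK
  have h2 : ContinuousOn (amp s φ) K := continuousOn_amp hφ
  fun_prop

theorem differentiableOn_exp_mul_amp (hN : Phase N I R ε δ) (hK : ∀ z ∈ K, R ≤ ‖z‖)
    (hφ : DifferentiableOn ℂ φ (interior K)) (x : ℝ) :
    DifferentiableOn ℂ (fun z => Complex.exp (Complex.I * N z * x) * amp s φ z)
      (interior K) := by
  have h1 : DifferentiableOn ℂ N (interior K) :=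
    fun z hz => (hN.diff z (hK z (interior_subset hz))).differentiableWithinAt
  have h2 : DifferentiableOn ℂ (amp s φ) (interior K) := differentiableOn_amp hφ
  fun_prop

theorem continuousOn_amp_mul_pow (hN : Phase N I R ε δ) (hK : ∀ z ∈ K, R ≤ ‖z‖)
    (hφ : ContinuousOn φ K) (m : ℕ) : ContinuousOn (fun z => amp s φ z * N z ^ m) K :=
  (continuousOn_amp hφ).mul ((hN.continuousOn.mono hK).pow m)

theorem exists_norm_exp_mul_amp_le (hN : Phase N I R ε δ) {x : ℝ} (hx : x ∈ I) :
    ∃ E : ℝ, 0 < E ∧ ∀ s φ, ∀ z ∈ stripS R ε ∪ sectorS R δ,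
      ‖Complex.exp (Complex.I * N z * x) * amp s φ z‖ ≤
        E * (Real.exp (s * (z ^ 3).im) * ‖φ z‖) := by
  obtain ⟨M, -, him⟩ := hN.im
  refine ⟨Real.exp (M * |x|), Real.exp_pos _, fun s φ z hz => ?_⟩
  rw [norm_mul, norm_amp]
  exact mul_le_mul_of_nonneg_right (norm_exp_I_mul_le (him x hx z hz)) (by positivity)

theorem integrableOn_exp_mul (hN : Phase N I R ε δ) (hR : 0 < R) {x : ℝ} (hx : x ∈ I)
    {D : Set ℝ} {p g : ℝ → ℂ} (hD : MeasurableSet D) (hp : ContinuousOn p D)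
    (hmem : ∀ r ∈ D, p r ∈ stripS R ε ∪ sectorS R δ) (hg : IntegrableOn g D) :
    IntegrableOn (fun r => Complex.exp (Complex.I * N (p r) * x) * g r) D := by
  obtain ⟨M, -, him⟩ := hN.im
  have h2 : ContinuousOn (fun r => N (p r)) D :=
    hN.continuousOn.comp hp fun r hr => le_norm_of_mem hR (hmem r hr)
  exact integrable_exp_mul (p := fun r => N (p r)) (M := M) (h2.aestronglyMeasurable hD)
    (ae_restrict_of_forall_mem hD fun r hr => him x hx _ (hmem r hr)) hg

end Phase

namespace Ray
variable {R ε δ κ s t : ℝ} {β : ℂ} {N φ θ ψ : ℂ → ℂ} {I : Set ℝ}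

theorem norm_mul_exp (h : Ray R ε δ κ β) {r : ℝ} (hr : 0 ≤ r) (μ : ℝ) :
    ‖β * (r * Complex.exp (μ * Complex.I))‖ = r := by
  rw [norm_mul, norm_mul, h.norm, Complex.norm_exp_ofReal_mul_I, Complex.norm_real,
    Real.norm_of_nonneg hr, one_mul, mul_one]

theorem norm_mul_ofReal (h : Ray R ε δ κ β) {r : ℝ} (hr : 0 ≤ r) : ‖β * r‖ = r := by
  rw [norm_mul, h.norm, Complex.norm_real, Real.norm_of_nonneg hr, one_mul]

theorem le_norm_shift (h : Ray R ε δ κ β) (r y : ℝ) : r ≤ ‖β * (r + y * Complex.I)‖ := by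
  rw [norm_mul, h.norm, one_mul]
  exact (le_abs_self r).trans (abs_le_norm_ofReal_add_mul_I r y)

theorem mem_strip (h : Ray R ε δ κ β) {r : ℝ} (hr : R ≤ r) : β * r ∈ stripS R ε := by
  simpa using h.strip r 0 hr left_mem_uIcc

theorem mem_sector (h : Ray R ε δ κ β) {r : ℝ} (hr : R ≤ r) : β * r ∈ sectorS R δ := by
  simpa using h.sector r 0 hr left_mem_uIcc

/-- At full height `ε` the amplitude is at most `e^{-2 s ε r²}` far out, while `‖z‖ ≤ r + ε ≤ 2r`
bounds `N^m` by `(2 B r)^m`. -/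
theorem integrableOn_amp_shift (h : Ray R ε δ κ β) (hR : 0 < R) (hε : 0 < ε)
    (hN : Phase N I R ε δ) (hs : 0 < s) (hφ : ContinuousOn φ (stripS R ε))
    (hlim : Tendsto φ (cobounded ℂ ⊓ 𝓟 (stripS R ε)) (𝓝 0)) (m : ℕ) :
    IntegrableOn (fun r : ℝ => amp s φ (β * (r + (-(κ * ε) : ℝ) * Complex.I)) *
      N (β * (r + (-(κ * ε) : ℝ) * Complex.I)) ^ m) (Ici R) := by
  have hK : ∀ z ∈ stripS R ε, R ≤ ‖z‖ := fun z hz => le_norm_of_mem (δ := δ) hR (.inl hz)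
  obtain ⟨B, hB, hgrow⟩ := hN.growth
  obtain ⟨r₀, hr₀⟩ := exists_norm_le_of_tendsto_cobounded hlim one_pos
  have habs : |(-(κ * ε))| = ε := by
    rcases h.kappa with rfl | rfl <;> simp [abs_of_pos hε]
  refine integrableOn_Ici_of_gaussian_decay (A := (2 * B) ^ m) (b := s * (2 * ε)) (m := m)
    (by positivity) ?_ ?_
  · exact (hN.continuousOn_amp_mul_pow hK hφ m).comp (by fun_prop)
      fun r hr => h.strip r _ hr right_mem_uIcc
  · filter_upwards [eventually_ge_atTop R, eventually_ge_atTop ε, eventually_gt_atTop r₀]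
      with r hrR hrε hr0
    set z := β * (r + (-(κ * ε) : ℝ) * Complex.I) with hz
    have hrz : r ≤ ‖z‖ := h.le_norm_shift r _
    have hzr : ‖z‖ ≤ 2 * r := by
      rw [hz, norm_mul, h.norm, one_mul]
      refine (norm_add_le _ _).trans ?_
      rw [norm_mul, Complex.norm_I, Complex.norm_real, Complex.norm_real, Real.norm_eq_abs,
        Real.norm_eq_abs, habs, abs_of_pos (hR.trans_le hrR)]
      linarith
    have h1 := hr₀ z (h.strip r _ hrR right_mem_uIcc) (hr0.trans_le hrz)
    have h2 := h.im_cube_shift_le hε hrε right_mem_uIcc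
    rw [← hz, habs] at h2
    have h3 : ‖N z‖ ≤ 2 * B * r := by
      refine (hgrow z (hrR.trans hrz)).trans ?_
      nlinarith
    rw [norm_mul, norm_pow, norm_amp]
    calc Real.exp (s * (z ^ 3).im) * ‖φ z‖ * ‖N z‖ ^ m
        ≤ Real.exp (-(s * (2 * ε) * r ^ 2)) * 1 * (2 * B * r) ^ m := by
          gcongr
          linarith [mul_le_mul_of_nonneg_left h2 hs.le]
      _ = _ := by rw [mul_pow]; ring

theorem tendsto_integral_shift (h : Ray R ε δ κ β) (hR : 0 < R) (hε : 0 < ε)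
    (hN : Phase N I R ε δ) (hs : 0 < s) (hφ : ContinuousOn φ (stripS R ε))
    (hφ' : DifferentiableOn ℂ φ (interior (stripS R ε)))
    (hlim : Tendsto φ (cobounded ℂ ⊓ 𝓟 (stripS R ε)) (𝓝 0)) {x : ℝ} (hx : x ∈ I)
    {F : ℂ → ℂ} (hF : F = fun z => Complex.exp (Complex.I * N z * x) * amp s φ z) :
    Tendsto (fun C => ∫ r in R..C, F (β * r) * β) atTop
      (𝓝 ((∫ y in (0 : ℝ)..-(κ * ε), F (β * (R + y * Complex.I)) * (β * Complex.I))
        + ∫ r in Ici R, F (β * (r + (-(κ * ε) : ℝ) * Complex.I)) * β)) := by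
  have hK : ∀ z ∈ stripS R ε, R ≤ ‖z‖ := fun z hz => le_norm_of_mem (δ := δ) hR (.inl hz)
  have hc : ContinuousOn F (stripS R ε) := hF ▸ hN.continuousOn_exp_mul_amp hK hφ x
  have hd : DifferentiableOn ℂ F (interior (stripS R ε)) :=
    hF ▸ hN.differentiableOn_exp_mul_amp hK hφ' x
  obtain ⟨E, hE, hb⟩ := hN.exists_norm_exp_mul_amp_le hx
  refine tendsto_integral_ray_shift h.norm h.strip hc hd ?_ fun η hη => ?_
  · have h1 := h.integrableOn_amp_shift hR hε hN hs hφ hlim 0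
    simp only [pow_zero, mul_one] at h1
    have h2 := hN.integrableOn_exp_mul hR hx (measurableSet_Ici (a := R))
      (p := fun r : ℝ => β * (r + (-(κ * ε) : ℝ) * Complex.I)) (by fun_prop)
      (fun r hr => .inl (h.strip r _ hr right_mem_uIcc)) h1
    simpa only [hF] using h2
  · obtain ⟨r₀, hr₀⟩ := exists_norm_le_of_tendsto_cobounded hlim
      (η := η / E) (by positivity)
    filter_upwards [eventually_ge_atTop R, eventually_ge_atTop ε, eventually_gt_atTop r₀]
      with r hrR hrε hr0 y hy
    have hmem := h.strip r y hrR hy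
    have h1 := hr₀ _ hmem (hr0.trans_le (h.le_norm_shift r y))
    have h2 := h.im_cube_shift_le hε hrε hy
    have h4 := hb s φ _ (.inl hmem)
    rw [hF]
    generalize β * (r + y * Complex.I) = z at *
    -- At `y = 0` the exponential does not decay at all, so the smallness on the closing segment has
    -- to come from `φ`.
    have h3 : Real.exp (s * (z ^ 3).im) ≤ 1 := by
      rw [Real.exp_le_one_iff]
      have : 0 ≤ 2 * |y| * r ^ 2 := by positivity
      exact mul_nonpos_of_nonneg_of_nonpos hs.le (by linarith)
    calc _ ≤ E * (Real.exp (s * (z ^ 3).im) * ‖φ z‖) := h4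
      _ ≤ E * (1 * (η / E)) := by gcongr
      _ = η := by field_simp

theorem integrableOn_amp_rotate (h : Ray R ε δ κ β) (hR : 0 < R) (hδ : 0 < δ) (hδ' : δ < π / 6)
    (hN : Phase N I R ε δ) (hs : s < 0) (hφ : ContinuousOn φ (sectorS R δ))
    (hlim : Tendsto φ (cobounded ℂ ⊓ 𝓟 (sectorS R δ)) (𝓝 0)) (m : ℕ) :
    IntegrableOn (fun r : ℝ => amp s φ (β * Complex.exp ((κ * δ : ℝ) * Complex.I) * r) *
      N (β * Complex.exp ((κ * δ : ℝ) * Complex.I) * r) ^ m) (Ici R) := by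
  have hK : ∀ z ∈ sectorS R δ, R ≤ ‖z‖ := fun z hz => le_norm_of_mem (ε := ε) hR (.inr hz)
  have hcomm : ∀ r : ℝ, β * Complex.exp ((κ * δ : ℝ) * Complex.I) * r =
      β * (r * Complex.exp ((κ * δ : ℝ) * Complex.I)) := fun r => by ring
  simp only [hcomm]
  obtain ⟨B, hB, hgrow⟩ := hN.growth
  obtain ⟨r₀, hr₀⟩ := exists_norm_le_of_tendsto_cobounded hlim one_pos
  have habs : |κ * δ| = δ := by
    rcases h.kappa with rfl | rfl <;> simp [abs_of_pos hδ]
  have hπ := Real.pi_pos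
  refine integrableOn_Ici_of_gaussian_decay (A := B ^ m) (b := -s * (6 / π * δ)) (m := m)
    (mul_pos (neg_pos.2 hs) (by positivity)) ?_ ?_
  · exact (hN.continuousOn_amp_mul_pow hK hφ m).comp (by fun_prop)
      fun r hr => h.sector r _ hr right_mem_uIcc
  · filter_upwards [eventually_ge_atTop R, eventually_ge_atTop 1, eventually_gt_atTop r₀]
      with r hrR hr1 hr0
    have hr : 0 ≤ r := hR.le.trans hrR
    have hzr := h.norm_mul_exp hr (κ * δ)
    have h2 := h.le_im_cube_rotate hδ hδ' hr right_mem_uIcc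
    have h1 := hr₀ _ (h.sector r _ hrR right_mem_uIcc) (by rwa [hzr])
    have h3 := hgrow _ (hrR.trans_eq hzr.symm)
    set z := β * (r * Complex.exp ((κ * δ : ℝ) * Complex.I))
    rw [hzr] at h3
    rw [habs] at h2
    -- For `r ≥ 1` the cubic exponent is weakened to the quadratic one required for Gaussian decay.
    have h4 : 6 / π * δ * r ^ 2 ≤ 6 / π * δ * r ^ 3 :=
      mul_le_mul_of_nonneg_left (pow_le_pow_right₀ hr1 (by norm_num)) (by positivity)
    rw [norm_mul, norm_pow, norm_amp]
    calc Real.exp (s * (z ^ 3).im) * ‖φ z‖ * ‖N z‖ ^ m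
        ≤ Real.exp (-(-s * (6 / π * δ) * r ^ 2)) * 1 * (B * r) ^ m := by
          gcongr
          linarith [mul_le_mul_of_nonpos_left (h4.trans h2) hs.le]
      _ = _ := by rw [mul_pow]; ring

theorem tendsto_integral_rotate (h : Ray R ε δ κ β) (hR : 0 < R) (hδ : 0 < δ) (hδ' : δ < π / 6)
    (hN : Phase N I R ε δ) (hs : s < 0) (hφ : ContinuousOn φ (sectorS R δ))
    (hφ' : DifferentiableOn ℂ φ (interior (sectorS R δ)))
    (hlim : Tendsto φ (cobounded ℂ ⊓ 𝓟 (sectorS R δ)) (𝓝 0)) {x : ℝ} (hx : x ∈ I)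
    {F : ℂ → ℂ} (hF : F = fun z => Complex.exp (Complex.I * N z * x) * amp s φ z) :
    Tendsto (fun C => ∫ r in R..C, F (β * r) * β) atTop
      (𝓝 ((∫ μ in (0 : ℝ)..κ * δ, F (β * (R * Complex.exp (μ * Complex.I))) *
          (β * (R * Complex.exp (μ * Complex.I)) * Complex.I))
        + ∫ r in Ici R, F (β * Complex.exp ((κ * δ : ℝ) * Complex.I) * r) *
          (β * Complex.exp ((κ * δ : ℝ) * Complex.I)))) := by
  have hK : ∀ z ∈ sectorS R δ, R ≤ ‖z‖ := fun z hz => le_norm_of_mem (ε := ε) hR (.inr hz)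
  have hπ := Real.pi_pos
  have hc : ContinuousOn F (sectorS R δ) := hF ▸ hN.continuousOn_exp_mul_amp hK hφ x
  have hd : DifferentiableOn ℂ F (interior (sectorS R δ)) :=
    hF ▸ hN.differentiableOn_exp_mul_amp hK hφ' x
  obtain ⟨E, hE, hb⟩ := hN.exists_norm_exp_mul_amp_le hx
  refine tendsto_integral_ray_rotate h.norm hR (b := -s * (6 / π))
    (mul_pos (neg_pos.2 hs) (by positivity)) h.sector hc hd ?_ fun η hη => ?_
  · have h1 := h.integrableOn_amp_rotate hR hδ hδ' hN hs hφ hlim 0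
    simp only [pow_zero, mul_one] at h1
    have hmem : ∀ r ∈ Ici R, β * Complex.exp ((κ * δ : ℝ) * Complex.I) * r ∈ sectorS R δ :=
      fun r hr => by
        convert h.sector r _ hr right_mem_uIcc using 1
        ring
    have h2 := hN.integrableOn_exp_mul hR hx (measurableSet_Ici (a := R))
      (p := fun r : ℝ => β * Complex.exp ((κ * δ : ℝ) * Complex.I) * r) (by fun_prop)
      (fun r hr => .inr (hmem r hr)) h1
    simpa only [hF] using h2
  · obtain ⟨r₀, hr₀⟩ := exists_norm_le_of_tendsto_cobounded hlim
      (η := η / E) (by positivity)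
    filter_upwards [eventually_ge_atTop R, eventually_gt_atTop r₀] with r hrR hr0 μ hμ
    have hr : 0 ≤ r := hR.le.trans hrR
    have hmem := h.sector r μ hrR hμ
    have h1 := hr₀ _ hmem (by rwa [h.norm_mul_exp hr])
    have h2 := h.le_im_cube_rotate hδ hδ' hr hμ
    have h4 := hb s φ _ (.inr hmem)
    rw [hF]
    generalize β * (r * Complex.exp (μ * Complex.I)) = z at *
    have h3 : s * (z ^ 3).im ≤ -(-s * (6 / π) * r ^ 3 * |μ|) := by
      linarith [mul_le_mul_of_nonpos_left h2 hs.le]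
    calc _ ≤ E * (Real.exp (s * (z ^ 3).im) * ‖φ z‖) := h4
      _ ≤ E * (Real.exp (-(-s * (6 / π) * r ^ 3 * |μ|)) * (η / E)) := by gcongr
      _ = _ := by field_simp

end Ray

/-! ### Splitting the integral along one ray -/

namespace Ray
variable {R ε δ κ s t τ τ' : ℝ} {β : ℂ} {N φ φt θ ψ : ℂ → ℂ} {I : Set ℝ}

theorem norm_amp_eq (h : Ray R ε δ κ β) (r : ℝ) : ‖amp t θ (β * r)‖ = ‖θ (β * r)‖ := by
  have : ((β * r) ^ 3).im = 0 := by
    rw [mul_pow, h.cube, Complex.im_ofReal_mul, ← Complex.ofReal_pow, Complex.ofReal_im, mul_zero]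
  rw [norm_amp, this, mul_zero, Real.exp_zero, one_mul]

theorem integrableOn_amp (h : Ray R ε δ κ β)
    (hθ : IntegrableOn (fun r : ℝ => θ (β * r)) (Ici R)) :
    IntegrableOn (fun r : ℝ => amp t θ (β * r)) (Ici R) := by
  refine Integrable.mono hθ ?_ (ae_of_all _ fun r => (h.norm_amp_eq r).le)
  exact AEStronglyMeasurable.mul (Continuous.aestronglyMeasurable (by fun_prop)) hθ.1

theorem integrableOn_exp_mul_amp (h : Ray R ε δ κ β) (hR : 0 < R) (hN : Phase N I R ε δ)
    {x : ℝ} (hx : x ∈ I) (hθ : IntegrableOn (fun r : ℝ => θ (β * r)) (Ici R)) :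
    IntegrableOn (fun r : ℝ => Complex.exp (Complex.I * N (β * r) * x) * amp t θ (β * r))
      (Ici R) :=
  hN.integrableOn_exp_mul hR hx measurableSet_Ici (p := fun r : ℝ => β * r) (by fun_prop)
    (fun _ hr => .inl (h.mem_strip hr)) (h.integrableOn_amp hθ)

/-- On the ray `e^{-i z³ t}` is unimodular. Far out `N^m` costs at most a multiple of `r²`, which
leaves `r⁻²` of the decay `r⁻⁴`; nearer in, `r^m` is bounded and `ψ` is integrable. The sum of the
two bounds serves as one majorant. -/
theorem integrableOn_amp_mul_pow (h : Ray R ε δ κ β) (hR : 0 < R) (hN : Phase N I R ε δ)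
    {c : Set ℂ} (hc : ∀ r : ℝ, R ≤ r → β * r ∈ c)
    (hψ : IntegrableOn (fun r : ℝ => ψ (β * r)) (Ici R))
    (hO : ψ =O[cobounded ℂ ⊓ 𝓟 c] fun z => z ^ (-4 : ℤ)) {m : ℕ} (hm : m ≤ 2) :
    IntegrableOn (fun r : ℝ => amp t ψ (β * r) * N (β * r) ^ m) (Ici R) := by
  obtain ⟨A, hA, hO⟩ := hO.exists_nonneg
  obtain ⟨B, hB, hgrow⟩ := hN.growth
  have h1 := hO.bound
  rw [eventually_inf_principal,
    (Metric.hasBasis_cobounded_compl_closedBall (0 : ℂ)).eventually_iff] at h1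
  obtain ⟨r₀, -, hr₀⟩ := h1
  -- Beyond `r₀` the `O(z⁻⁴)` bound is in force, and `r ≥ 1` is what gives `r^m ≤ r²`.
  set r₁ := max r₀ 1 with hr₁
  have hr₁1 : 1 ≤ r₁ := le_max_right _ _
  have hsq : IntegrableOn (fun r : ℝ => r ^ (-2 : ℝ)) (Ici R) := by
    rw [integrableOn_Ici_iff_integrableOn_Ioi]
    exact integrableOn_Ioi_rpow_of_lt (by norm_num) hR
  have hNm : ContinuousOn (fun r : ℝ => N (β * r) ^ m) (Ici R) :=
    (hN.continuousOn.comp (by fun_prop) fun r hr =>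
      le_norm_of_mem (δ := δ) hR (.inl (h.mem_strip hr))).pow m
  refine Integrable.mono' (g := fun r : ℝ => B ^ m * (r₁ ^ m * ‖ψ (β * r)‖ + A * r ^ (-2 : ℝ)))
    (((hψ.norm.const_mul _).add (hsq.const_mul A)).const_mul _)
    ((h.integrableOn_amp hψ).1.mul (hNm.aestronglyMeasurable measurableSet_Ici))
    (ae_restrict_of_forall_mem measurableSet_Ici fun r hr => ?_)
  have hr0 : 0 < r := hR.trans_le hr
  have hnr := h.norm_mul_ofReal hr0.le
  have h2 : ‖N (β * r)‖ ^ m ≤ B ^ m * r ^ m := by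
    rw [← mul_pow]
    refine pow_le_pow_left₀ (norm_nonneg _) ?_ m
    have := hgrow (β * r) (by rw [hnr]; exact hr)
    rwa [hnr] at this
  have hrp : r ^ (-2 : ℝ) = (r ^ 2)⁻¹ := by
    rw [Real.rpow_neg hr0.le]; norm_cast
  have h3 : r ^ m * ‖ψ (β * r)‖ ≤ r₁ ^ m * ‖ψ (β * r)‖ + A * r ^ (-2 : ℝ) := by
    rcases le_total r r₁ with hle | hle
    · have : r ^ m * ‖ψ (β * r)‖ ≤ r₁ ^ m * ‖ψ (β * r)‖ := by gcongr
      have : 0 ≤ A * r ^ (-2 : ℝ) := by positivity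
      linarith
    -- The `O(z⁻⁴)` bound holds only strictly outside the ball of radius `r₀`; at `r = r₁` the first
    -- majorant suffices.
    · rcases hle.eq_or_lt with rfl | hlt
      · have : 0 ≤ A * r₁ ^ (-2 : ℝ) := by positivity
        linarith
      have h4 := hr₀ (x := β * r) (by
        rw [mem_compl_iff, mem_closedBall_zero_iff, hnr, not_le]
        exact (le_max_left _ _).trans_lt hlt) (hc r hr)
      rw [norm_zpow, hnr] at h4
      have h5 : r ^ m ≤ r ^ 2 := pow_le_pow_right₀ (hr₁1.trans hle) hm
      have h6 : r ^ m * ‖ψ (β * r)‖ ≤ r ^ 2 * (A * r ^ (-4 : ℤ)) := by gcongr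
      have h7 : r ^ 2 * (A * r ^ (-4 : ℤ)) = A * r ^ (-2 : ℝ) := by
        rw [hrp, zpow_neg]
        norm_cast
        field_simp
      have : 0 ≤ r₁ ^ m * ‖ψ (β * r)‖ := by positivity
      linarith
  rw [norm_mul, norm_pow, h.norm_amp_eq]
  calc ‖ψ (β * r)‖ * ‖N (β * r)‖ ^ m ≤ ‖ψ (β * r)‖ * (B ^ m * r ^ m) := by gcongr
    _ = B ^ m * (r ^ m * ‖ψ (β * r)‖) := by ring
    _ ≤ _ := by gcongr

/-- Deformation of the integral along a ray of `∂D`. The terms in `φ` and `φt` need not converge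
absolutely along the ray itself. -/
theorem integral_eq (h : Ray R ε δ κ β) (hR : 0 < R) (hε : 0 < ε) (hδ : 0 < δ)
    (hδ' : δ < π / 6) (hN : Phase N I R ε δ) (ht : t ∈ Ioo τ' τ)
    (hφ : ContinuousOn φ (stripS R ε)) (hφ' : DifferentiableOn ℂ φ (interior (stripS R ε)))
    (hφ_lim : Tendsto φ (cobounded ℂ ⊓ 𝓟 (stripS R ε)) (𝓝 0))
    (hφt : ContinuousOn φt (sectorS R δ)) (hφt' : DifferentiableOn ℂ φt (interior (sectorS R δ)))
    (hφt_lim : Tendsto φt (cobounded ℂ ⊓ 𝓟 (sectorS R δ)) (𝓝 0))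
    (hθ : IntegrableOn (fun r : ℝ => θ (β * r)) (Ici R))
    (hψ : IntegrableOn (fun r : ℝ => ψ (β * r)) (Ici R))
    (hrep : ∀ᵐ r : ℝ ∂volume.restrict (Ici R), amp t θ (β * r) =
      amp (t - τ') φ (β * r) + amp (t - τ) φt (β * r) + amp t ψ (β * r))
    {x : ℝ} (hx : x ∈ I) {Fθ Fφ Fφt Fψ : ℂ → ℂ}
    (hFθ : Fθ = fun z => Complex.exp (Complex.I * N z * x) * amp t θ z)
    (hFφ : Fφ = fun z => Complex.exp (Complex.I * N z * x) * amp (t - τ') φ z)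
    (hFφt : Fφt = fun z => Complex.exp (Complex.I * N z * x) * amp (t - τ) φt z)
    (hFψ : Fψ = fun z => Complex.exp (Complex.I * N z * x) * amp t ψ z) :
    ∫ r in Ici R, Fθ (β * r) * β =
      (∫ r in Ici R, Fψ (β * r) * β)
      + ((∫ y in (0 : ℝ)..-(κ * ε), Fφ (β * (R + y * Complex.I)) * (β * Complex.I))
        + ∫ r in Ici R, Fφ (β * (r + (-(κ * ε) : ℝ) * Complex.I)) * β)
      + ((∫ μ in (0 : ℝ)..κ * δ, Fφt (β * (R * Complex.exp (μ * Complex.I))) *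
          (β * (R * Complex.exp (μ * Complex.I)) * Complex.I))
        + ∫ r in Ici R, Fφt (β * Complex.exp ((κ * δ : ℝ) * Complex.I) * r) *
          (β * Complex.exp ((κ * δ : ℝ) * Complex.I))) := by
  have l1 := h.tendsto_integral_shift hR hε hN (sub_pos.2 ht.1) hφ hφ' hφ_lim hx hFφ
  have l2 := h.tendsto_integral_rotate hR hδ hδ' hN (sub_neg.2 ht.2) hφt hφt' hφt_lim hx hFφt
  have iθ : IntegrableOn (fun r : ℝ => Fθ (β * r) * β) (Ici R) := by
    rw [hFθ]; exact (h.integrableOn_exp_mul_amp hR hN hx hθ).mul_const β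
  have iψ : IntegrableOn (fun r : ℝ => Fψ (β * r) * β) (Ici R) := by
    rw [hFψ]; exact (h.integrableOn_exp_mul_amp hR hN hx hψ).mul_const β
  have lθ := intervalIntegral_tendsto_integral_Ioi R (iθ.mono_set Ioi_subset_Ici_self) tendsto_id
  have lψ := intervalIntegral_tendsto_integral_Ioi R (iψ.mono_set Ioi_subset_Ici_self) tendsto_id
  rw [← integral_Ici_eq_integral_Ioi] at lθ lψ
  -- The decomposition of `θ` is integrated only up to a finite `C`, where every term is integrable.
  -- Both sides are then limits of the same truncated integrals.
  refine tendsto_nhds_unique lθ (((lψ.add l1).add l2).congr' ?_)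
  filter_upwards [eventually_ge_atTop R] with C hC
  have hsub : uIcc R C ⊆ Ici R := by rw [uIcc_of_le hC]; exact Icc_subset_Ici_self
  have cφ : ContinuousOn Fφ (stripS R ε) := hFφ ▸ hN.continuousOn_exp_mul_amp
    (fun z hz => le_norm_of_mem (δ := δ) hR (.inl hz)) hφ x
  have cφt : ContinuousOn Fφt (sectorS R δ) := hFφt ▸ hN.continuousOn_exp_mul_amp
    (fun z hz => le_norm_of_mem (ε := ε) hR (.inr hz)) hφt x
  have jφ : IntervalIntegrable (fun r : ℝ => Fφ (β * r) * β) volume R C :=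
    ((cφ.comp (by fun_prop) fun r hr => h.mem_strip (hsub hr)).mul
      continuousOn_const).intervalIntegrable
  have jφt : IntervalIntegrable (fun r : ℝ => Fφt (β * r) * β) volume R C :=
    ((cφt.comp (by fun_prop) fun r hr => h.mem_sector (hsub hr)).mul
      continuousOn_const).intervalIntegrable
  have jψ : IntervalIntegrable (fun r : ℝ => Fψ (β * r) * β) volume R C :=
    (iψ.mono_set hsub).intervalIntegrable
  rw [id, ← intervalIntegral.integral_add jψ jφ,
    ← intervalIntegral.integral_add (jψ.add jφ) jφt]
  refine intervalIntegral.integral_congr_ae_restrict ?_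
  refine (ae_restrict_of_ae_restrict_of_subset (uIoc_subset_uIcc.trans hsub) hrep).mono
    fun r hr => ?_
  simp only [hFθ, hFφ, hFφt, hFψ, hr]
  ring

end Ray

/-! ### From arc length to parametrizations -/

theorem Contour.map_le_arcLength {c : Contour} {p : Piece} (hp : p ∈ c) :
    ((volume.restrict p.dom).withDensity
      fun u => ENNReal.ofReal ‖deriv p.path u‖).map p.path ≤ c.arcLength := by
  induction c with
  | nil => simp at hp
  | cons q c ih =>
    rw [Contour.arcLength, List.map_cons, List.sum_cons]
    rcases List.mem_cons.1 hp with rfl | hp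
    · exact Measure.le_add_right le_rfl
    · exact Measure.le_add_left (ih hp)

theorem withDensity_norm_deriv {p : Piece} {d : ℝ} (hd : ∀ u, ‖deriv p.path u‖ = d) :
    (volume.restrict p.dom).withDensity (fun u => ENNReal.ofReal ‖deriv p.path u‖) =
      ENNReal.ofReal d • volume.restrict p.dom := by
  simp only [hd, withDensity_const]

/-- Arc length dominates the push-forward from each single piece. At constant speed `d` the density
is a scalar, which can be divided out because `d > 0`. -/
theorem Contour.integrableOn_of_memLp {c : Contour} {p : Piece} (hp : p ∈ c) {f : ℂ → ℂ}
    (hf : MemLp f 1 c.arcLength) {d : ℝ} (hd0 : 0 < d) (hd : ∀ u, ‖deriv p.path u‖ = d)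
    (hc : Continuous p.path) : IntegrableOn (fun u => f (p.path u)) p.dom := by
  have h1 := (memLp_one_iff_integrable.1 hf).mono_measure (Contour.map_le_arcLength hp)
  rw [withDensity_norm_deriv hd] at h1
  have h2 := h1.comp_measurable hc.measurable
  rwa [integrable_smul_measure (by simpa using hd0) ENNReal.ofReal_ne_top] at h2

theorem Contour.ae_of_ae_arcLength {c : Contour} {p : Piece} (hp : p ∈ c) {P : ℂ → Prop}
    (h : ∀ᵐ z ∂c.arcLength, P z) {d : ℝ} (hd0 : 0 < d) (hd : ∀ u, ‖deriv p.path u‖ = d)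
    (hc : Continuous p.path) : ∀ᵐ u ∂volume.restrict p.dom, P (p.path u) := by
  have h1 := ae_mono (Contour.map_le_arcLength hp) h
  rw [withDensity_norm_deriv hd] at h1
  have h2 := ae_of_ae_map hc.aemeasurable h1
  rwa [Measure.ae_ennreal_smul_measure_eq (by simpa using hd0)] at h2

theorem integrableOn_Iic_neg_iff {f : ℝ → ℂ} {R : ℝ} :
    IntegrableOn f (Iic (-R)) ↔ IntegrableOn (fun r => f (-r)) (Ici R) := by
  have := (Measure.measurePreserving_neg (volume : Measure ℝ)).integrableOn_comp_preimage
    (MeasurableEquiv.neg ℝ).measurableEmbedding (f := f) (s := Iic (-R))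
  rw [← this]
  have hs : (fun x : ℝ => -x) ⁻¹' Iic (-R) = Ici R := by ext; simp
  change IntegrableOn _ ((fun x : ℝ => -x) ⁻¹' Iic (-R)) _ ↔ _
  rw [hs]
  rfl

theorem setIntegral_Iic_neg (f : ℝ → ℂ) (R : ℝ) :
    ∫ u in Iic (-R), f u = ∫ r in Ici R, f (-r) := by
  rw [integral_Ici_eq_integral_Ioi, integral_comp_neg_Ioi]

theorem ae_restrict_Ici_of_Iic_neg {P : ℝ → Prop} {R : ℝ}
    (h : ∀ᵐ u ∂volume.restrict (Iic (-R)), P u) : ∀ᵐ r ∂volume.restrict (Ici R), P (-r) := by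
  rw [ae_restrict_iff' measurableSet_Iic] at h
  rw [ae_restrict_iff' measurableSet_Ici]
  have := (Measure.measurePreserving_neg (volume : Measure ℝ)).quasiMeasurePreserving.ae h
  filter_upwards [this] with r hr hR
  exact hr (neg_le_neg (mem_Ici.1 hR))

theorem Contour.phaseBound {c : Contour} {N : ℂ → ℂ} {I : Set ℝ} {R ε δ M : ℝ} (hR : 0 < R)
    (hN : Phase N I R ε δ)
    (hM : ∀ x ∈ I, ∀ z ∈ stripS R ε ∪ sectorS R δ, -(M * |x|) ≤ x * (N z).im)
    (hc : ∀ p ∈ c, MeasurableSet p.dom ∧ Continuous p.path ∧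
      ∀ u ∈ p.dom, p.path u ∈ stripS R ε ∪ sectorS R δ) : c.PhaseBound N I M := by
  refine ⟨fun p hp => ?_, fun p hp => ?_⟩ <;> obtain ⟨h1, h2, h3⟩ := hc p hp
  · exact (hN.continuousOn.comp h2.continuousOn fun u hu =>
      le_norm_of_mem hR (h3 u hu)).aestronglyMeasurable h1
  · exact ae_restrict_of_forall_mem h1 fun u hu x hx => hM x hx _ (h3 u hu)

theorem hasDerivAt_const_mul_ofReal (c : ℂ) (u : ℝ) : HasDerivAt (fun u : ℝ => c * (u : ℂ)) c u := by
  simpa using (Complex.ofRealCLM.hasDerivAt (x := u)).const_mul c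

theorem deriv_const_mul_ofReal (c : ℂ) : deriv (fun u : ℝ => c * (u : ℂ)) = fun _ => c :=
  funext fun u => (hasDerivAt_const_mul_ofReal c u).deriv

theorem deriv_mul_ofReal_sub (c d : ℂ) :
    deriv (fun u : ℝ => c * ((u : ℂ) - d)) = fun _ => c := by
  ext u
  simp only [mul_sub]
  exact ((hasDerivAt_const_mul_ofReal c u).sub_const _).deriv

theorem deriv_mul_add_I_mul (c d : ℂ) :
    deriv (fun u : ℝ => c * (d + Complex.I * (u : ℂ))) = fun _ => c * Complex.I := by
  ext u
  simp only [mul_add, ← mul_assoc]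
  exact ((hasDerivAt_const_mul_ofReal (c * Complex.I) u).const_add _).deriv

theorem deriv_mul_sub_I_mul (c d : ℂ) :
    deriv (fun u : ℝ => c * (d - Complex.I * (u : ℂ))) = fun _ => -(c * Complex.I) := by
  ext u
  simp only [mul_sub, ← mul_assoc]
  exact ((hasDerivAt_const_mul_ofReal (c * Complex.I) u).const_sub _).deriv

theorem deriv_arc (R : ℝ) : deriv (fun u : ℝ => (R : ℂ) * Complex.exp (-(Complex.I * u))) =
    fun u : ℝ => -(R * Complex.exp (-(Complex.I * u)) * Complex.I) := by
  ext u
  refine ((((hasDerivAt_const_mul_ofReal Complex.I u).neg).cexp.const_mul (R : ℂ)).congr_deriv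
    ?_).deriv
  rw [Pi.neg_apply]
  ring

/-! ### The three contours in terms of outward rays and arcs -/

/-- The integral of `f` along the circle `|z| = R`, clockwise from argument `-a` to `-b`. -/
noncomputable def arcIntegral (R : ℝ) (f : ℂ → ℂ) (a b : ℝ) : ℂ :=
  ∫ u in a..b, f (R * Complex.exp (-(Complex.I * u))) *
    -(R * Complex.exp (-(Complex.I * u)) * Complex.I)

theorem setIntegral_Icc_eq (f : ℝ → ℂ) {a b : ℝ} (h : a ≤ b) :
    ∫ u in Icc a b, f u = ∫ u in a..b, f u := by
  rw [integral_Icc_eq_integral_Ioc, intervalIntegral.integral_of_le h]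

theorem integral_bdryD (R : ℝ) (f : ℂ → ℂ) : (bdryD R).integral f =
    -(∫ r in Ici R, f (-alpha * r) * -alpha) + arcIntegral R f (π / 3) (2 * π / 3)
      + ∫ r in Ici R, f (alpha ^ 2 * r) * alpha ^ 2 := by
  have hπ := Real.pi_pos
  simp only [bdryD, Contour.integral, List.map_cons, List.map_nil, List.sum_cons, List.sum_nil,
    deriv_const_mul_ofReal, deriv_arc, setIntegral_Iic_neg, arcIntegral,
    setIntegral_Icc_eq _ (show π / 3 ≤ 2 * π / 3 by linarith), Complex.ofReal_neg, mul_neg,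
    neg_mul, integral_neg, neg_neg]
  ring

/-- Each bracket groups a joining segment with its shifted ray, which is the shape of the limit
produced by shifting a ray of `∂D`. -/
theorem integral_contourGamma (R : ℝ) {ε : ℝ} (hε : 0 < ε) (f : ℂ → ℂ) :
    (contourGamma R ε).integral f =
    -((∫ y in (0 : ℝ)..ε, f (-alpha * (R + y * Complex.I)) * (-alpha * Complex.I))
        + ∫ r in Ici R, f (-alpha * (r + ε * Complex.I)) * -alpha)
      + arcIntegral R f (π / 3) (2 * π / 3)
      + ((∫ y in (0 : ℝ)..-ε, f (alpha ^ 2 * (R + y * Complex.I)) * (alpha ^ 2 * Complex.I))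
        + ∫ r in Ici R, f (alpha ^ 2 * (r + (-ε : ℝ) * Complex.I)) * alpha ^ 2) := by
  have hπ := Real.pi_pos
  have h2 := intervalIntegral.integral_comp_neg (a := 0) (b := ε)
    (fun u : ℝ => f (alpha * (-R + Complex.I * u)) * (alpha * Complex.I))
  have h4 := intervalIntegral.integral_comp_neg (a := 0) (b := ε)
    (fun y : ℝ => f (alpha ^ 2 * (R + y * Complex.I)) * (alpha ^ 2 * Complex.I))
  have e1 : ∀ y : ℝ, -alpha * (R + y * Complex.I) = alpha * (-R + Complex.I * (-y : ℝ)) :=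
    fun y => by push_cast; ring
  have e2 : ∀ r : ℝ, -alpha * (r + ε * Complex.I) = alpha * ((-r : ℝ) - Complex.I * ε) :=
    fun r => by push_cast; ring
  have e3 : ∀ r : ℝ, alpha ^ 2 * (r + (-ε : ℝ) * Complex.I) = alpha ^ 2 * (r - Complex.I * ε) :=
    fun r => by push_cast; ring
  have e4 : ∀ y : ℝ, alpha ^ 2 * (R + (-y : ℝ) * Complex.I) = alpha ^ 2 * (R - Complex.I * y) :=
    fun y => by push_cast; ring
  rw [neg_zero] at h2 h4
  rw [intervalIntegral.integral_symm (-ε) 0, ← h4]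
  simp only [contourGamma, Contour.integral, List.map_cons, List.map_nil, List.sum_cons,
    List.sum_nil, deriv_mul_ofReal_sub, deriv_mul_add_I_mul, deriv_mul_sub_I_mul, deriv_arc,
    setIntegral_Iic_neg, arcIntegral, e1, e2, e3, e4,
    setIntegral_Icc_eq _ (show π / 3 ≤ 2 * π / 3 by linarith), setIntegral_Icc_eq _ hε.le,
    setIntegral_Icc_eq _ (neg_nonpos.2 hε.le), ← h2]
  simp only [mul_neg, neg_mul, integral_neg, intervalIntegral.integral_neg]
  ring

theorem integral_contourGammaIn {R δ : ℝ} (hδ' : δ < π / 6) (f : ℂ → ℂ) :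
    (contourGammaIn R δ).integral f =
    -(∫ r in Ici R, f (-alpha * Complex.exp ((-δ : ℝ) * Complex.I) * r) *
        (-alpha * Complex.exp ((-δ : ℝ) * Complex.I)))
      + arcIntegral R f (π / 3 + δ) (2 * π / 3 - δ)
      + ∫ r in Ici R, f (alpha ^ 2 * Complex.exp (δ * Complex.I) * r) *
        (alpha ^ 2 * Complex.exp (δ * Complex.I)) := by
  have hπ := Real.pi_pos
  have e1 : ∀ r : ℝ, -alpha * Complex.exp ((-δ : ℝ) * Complex.I) * r =
      alpha * Complex.exp (-(Complex.I * δ)) * (-r : ℝ) := fun r => by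
    rw [show ((-δ : ℝ) : ℂ) * Complex.I = -(Complex.I * δ) by push_cast; ring]; push_cast; ring
  have e2 : -alpha * Complex.exp ((-δ : ℝ) * Complex.I) =
      -(alpha * Complex.exp (-(Complex.I * δ))) := by
    rw [show ((-δ : ℝ) : ℂ) * Complex.I = -(Complex.I * δ) by push_cast; ring]; ring
  simp only [e1, contourGammaIn, Contour.integral, List.map_cons, List.map_nil, List.sum_cons,
    List.sum_nil, deriv_const_mul_ofReal, deriv_arc, setIntegral_Iic_neg, arcIntegral,
    setIntegral_Icc_eq _ (show π / 3 + δ ≤ 2 * π / 3 - δ by linarith), mul_comm (δ : ℂ)]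
  simp only [e2, mul_neg, integral_neg, neg_neg]
  ring

/-- Substitute `u = b - μ`. Rotating a ray sweeps out a piece of the circle `|z| = R`; written as an
`arcIntegral`, it cancels the end of the arc of `∂D` that is absent from `γ`. -/
theorem integral_rotated_arc (R : ℝ) (f : ℂ → ℂ) {β : ℂ} {b : ℝ}
    (hβ : β = Complex.exp (-b * Complex.I)) (h : ℝ) :
    ∫ μ in (0 : ℝ)..h, f (β * (R * Complex.exp (μ * Complex.I))) *
      (β * (R * Complex.exp (μ * Complex.I)) * Complex.I) = -arcIntegral R f (b - h) b := by
  have h1 := intervalIntegral.integral_comp_sub_left (a := 0) (b := h)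
    (fun u : ℝ => f (R * Complex.exp (-(Complex.I * u))) *
      -(R * Complex.exp (-(Complex.I * u)) * Complex.I)) b
  have e : ∀ μ : ℝ, β * (R * Complex.exp (μ * Complex.I)) =
      R * Complex.exp (-(Complex.I * (b - μ : ℝ))) := fun μ => by
    rw [hβ, mul_left_comm, ← Complex.exp_add]
    congr 2; push_cast; ring
  rw [sub_zero] at h1
  simp only [e, arcIntegral]
  rw [← h1, ← intervalIntegral.integral_neg]
  simp only [mul_neg, neg_neg]

theorem continuousOn_arc {R a b : ℝ} {K : Set ℂ} {f : ℂ → ℂ} (hf : ContinuousOn f K)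
    (hK : ∀ u ∈ Icc a b, (R : ℂ) * Complex.exp (-(Complex.I * u)) ∈ K) :
    ContinuousOn (fun u : ℝ => f (R * Complex.exp (-(Complex.I * u))) *
      -(R * Complex.exp (-(Complex.I * u)) * Complex.I)) (Icc a b) :=
  (hf.comp (by fun_prop) hK).mul (by fun_prop)

theorem arc_mem_stripS {R ε u : ℝ} (hu : u ∈ Icc (π / 3) (2 * π / 3)) :
    (R : ℂ) * Complex.exp (-(Complex.I * u)) ∈ stripS R ε :=
  .inr ⟨-u, by linarith [hu.2], by linarith [hu.1], by push_cast; ring_nf⟩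

theorem arc_mem_sectorS {R δ u : ℝ} (hu : u ∈ Icc (π / 3) (2 * π / 3)) :
    (R : ℂ) * Complex.exp (-(Complex.I * u)) ∈ sectorS R δ :=
  .inr ⟨-u, by linarith [hu.2], by linarith [hu.1], by push_cast; ring_nf⟩

theorem arcIntegral_add {R : ℝ} {f : ℂ → ℂ} {a b c : ℝ} (hab : a ≤ b) (hbc : b ≤ c)
    (hf : ContinuousOn (fun u : ℝ => f (R * Complex.exp (-(Complex.I * u))) *
      -(R * Complex.exp (-(Complex.I * u)) * Complex.I)) (Icc a c)) :
    arcIntegral R f a b + arcIntegral R f b c = arcIntegral R f a c :=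
  intervalIntegral.integral_add_adjacent_intervals
    ((hf.mono (by rw [uIcc_of_le hab]; exact Icc_subset_Icc_right hbc)).intervalIntegrable)
    ((hf.mono (by rw [uIcc_of_le hbc]; exact Icc_subset_Icc_left hab)).intervalIntegrable)

/-- The path of a piece of `∂D` has constant speed. -/
theorem norm_deriv_bdryD {R : ℝ} (hR : 0 < R) {p : Piece} (hp : p ∈ bdryD R) :
    ∃ d, 0 < d ∧ (∀ u, ‖deriv p.path u‖ = d) ∧ Continuous p.path := by
  simp only [bdryD, List.mem_cons, List.not_mem_nil, or_false] at hp
  rcases hp with rfl | rfl | rfl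
  · exact ⟨1, one_pos, fun u => by rw [deriv_const_mul_ofReal, norm_alpha], by fun_prop⟩
  · refine ⟨R, hR, fun u => ?_, by fun_prop⟩
    rw [deriv_arc]
    simp [Complex.norm_exp, abs_of_pos hR]
  · exact ⟨1, one_pos, fun u => by rw [deriv_const_mul_ofReal, norm_pow, norm_alpha, one_pow],
      by fun_prop⟩

theorem bdryD_mem {R ε δ : ℝ} (hε : 0 < ε) (hδ : 0 < δ) {p : Piece} (hp : p ∈ bdryD R) :
    MeasurableSet p.dom ∧ Continuous p.path ∧
      ∀ u ∈ p.dom, p.path u ∈ stripS R ε ∪ sectorS R δ := by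
  simp only [bdryD, List.mem_cons, List.not_mem_nil, or_false] at hp
  rcases hp with rfl | rfl | rfl
  · refine ⟨measurableSet_Iic, by fun_prop, fun u hu => .inl ?_⟩
    simpa using (ray_in hε hδ).mem_strip (le_neg.1 hu)
  · exact ⟨measurableSet_Icc, by fun_prop, fun u hu => .inl (arc_mem_stripS hu)⟩
  · exact ⟨measurableSet_Ici, by fun_prop, fun u hu => .inl ((ray_out hε hδ).mem_strip hu)⟩

theorem contourGamma_mem {R ε δ : ℝ} (hε : 0 < ε) {p : Piece}
    (hp : p ∈ contourGamma R ε) : MeasurableSet p.dom ∧ Continuous p.path ∧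
      ∀ u ∈ p.dom, p.path u ∈ stripS R ε ∪ sectorS R δ := by
  simp only [contourGamma, List.mem_cons, List.not_mem_nil, or_false] at hp
  rcases hp with rfl | rfl | rfl | rfl | rfl
  · refine ⟨measurableSet_Iic, by fun_prop, fun u hu => .inl (.inl ?_)⟩
    exact ⟨-u, ε, le_neg.1 hu, hε.le, le_rfl, .inr (by push_cast; ring)⟩
  · refine ⟨measurableSet_Icc, by fun_prop, fun u hu => .inl (.inl ?_)⟩
    exact ⟨R, -u, le_rfl, by linarith [hu.2], by linarith [hu.1], .inr (by push_cast; ring)⟩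
  · exact ⟨measurableSet_Icc, by fun_prop, fun u hu => .inl (arc_mem_stripS hu)⟩
  · refine ⟨measurableSet_Icc, by fun_prop, fun u hu => .inl (.inl ?_)⟩
    exact ⟨R, u, le_rfl, hu.1, hu.2, .inl rfl⟩
  · refine ⟨measurableSet_Ici, by fun_prop, fun u hu => .inl (.inl ?_)⟩
    exact ⟨u, ε, hu, hε.le, le_rfl, .inl rfl⟩

theorem contourGammaIn_mem {R ε δ : ℝ} (hε : 0 < ε) (hδ : 0 < δ) {p : Piece}
    (hp : p ∈ contourGammaIn R δ) : MeasurableSet p.dom ∧ Continuous p.path ∧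
      ∀ u ∈ p.dom, p.path u ∈ stripS R ε ∪ sectorS R δ := by
  simp only [contourGammaIn, List.mem_cons, List.not_mem_nil, or_false] at hp
  rcases hp with rfl | rfl | rfl
  · refine ⟨measurableSet_Iic, by fun_prop, fun u hu => .inr ?_⟩
    have := (ray_in hε hδ).sector (-u) (-1 * δ) (le_neg.1 hu) right_mem_uIcc
    convert this using 1
    rw [show ((-1 * δ : ℝ) : ℂ) * Complex.I = -(Complex.I * δ) by push_cast; ring]
    push_cast; ring
  · refine ⟨measurableSet_Icc, by fun_prop, fun u hu => .inr (arc_mem_sectorS ?_)⟩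
    exact ⟨by linarith [hu.1], by linarith [hu.2]⟩
  · refine ⟨measurableSet_Ici, by fun_prop, fun u hu => .inr ?_⟩
    have := (ray_out hε hδ).sector u (1 * δ) hu right_mem_uIcc
    convert this using 1
    rw [one_mul, mul_comm (δ : ℂ)]
    ring

/-! ### Absolute convergence on `∂D`, `Γ` and `γ` -/

section Convergence
variable {R ε δ s t : ℝ} {N φ θ ψ : ℂ → ℂ} {I : Set ℝ}

theorem converges_contourGamma (hR : 0 < R) (hε : 0 < ε) (hδ : 0 < δ) (hN : Phase N I R ε δ)
    (hs : 0 < s) (hφ : ContinuousOn φ (stripS R ε))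
    (hlim : Tendsto φ (cobounded ℂ ⊓ 𝓟 (stripS R ε)) (𝓝 0)) (m : ℕ) :
    (contourGamma R ε).Converges fun z => amp s φ z * N z ^ m := by
  have hK : ∀ z ∈ stripS R ε, R ≤ ‖z‖ := fun z hz => le_norm_of_mem (δ := δ) hR (.inl hz)
  have hc := hN.continuousOn_amp_mul_pow (s := s) hK hφ m
  intro p hp
  simp only [contourGamma, List.mem_cons, List.not_mem_nil, or_false] at hp
  rcases hp with rfl | rfl | rfl | rfl | rfl
  · simp only [deriv_mul_ofReal_sub]
    rw [integrableOn_Iic_neg_iff]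
    refine Integrable.mul_const ?_ _
    have := (ray_in hε hδ).integrableOn_amp_shift hR hε hN hs hφ hlim m
    have e : ∀ r : ℝ, -alpha * (r + (-(-1 * ε) : ℝ) * Complex.I) =
      alpha * ((-r : ℝ) - Complex.I * ε) := fun r => by push_cast; ring
    simpa only [IntegrableOn, e] using this
  · refine ContinuousOn.integrableOn_Icc ?_
    simp only [deriv_mul_add_I_mul]
    refine (hc.comp (by fun_prop) fun u hu => .inl ?_).mul continuousOn_const
    exact ⟨R, -u, le_rfl, by linarith [hu.2], by linarith [hu.1], .inr (by push_cast; ring)⟩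
  · refine ContinuousOn.integrableOn_Icc ?_
    simp only [deriv_arc]
    exact continuousOn_arc hc fun u hu => arc_mem_stripS hu
  · refine ContinuousOn.integrableOn_Icc ?_
    simp only [deriv_mul_sub_I_mul]
    refine (hc.comp (by fun_prop) fun u hu => .inl ?_).mul continuousOn_const
    exact ⟨R, u, le_rfl, hu.1, hu.2, .inl rfl⟩
  · simp only [deriv_mul_ofReal_sub]
    refine Integrable.mul_const ?_ _
    have := (ray_out hε hδ).integrableOn_amp_shift hR hε hN hs hφ hlim m
    have e : ∀ r : ℝ, alpha ^ 2 * (r + (-(1 * ε) : ℝ) * Complex.I) =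
      alpha ^ 2 * (r - Complex.I * ε) := fun r => by push_cast; ring
    simpa only [IntegrableOn, e] using this

theorem converges_contourGammaIn (hR : 0 < R) (hε : 0 < ε) (hδ : 0 < δ) (hδ' : δ < π / 6)
    (hN : Phase N I R ε δ) (hs : s < 0) (hφ : ContinuousOn φ (sectorS R δ))
    (hlim : Tendsto φ (cobounded ℂ ⊓ 𝓟 (sectorS R δ)) (𝓝 0)) (m : ℕ) :
    (contourGammaIn R δ).Converges fun z => amp s φ z * N z ^ m := by
  have hK : ∀ z ∈ sectorS R δ, R ≤ ‖z‖ := fun z hz => le_norm_of_mem (ε := ε) hR (.inr hz)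
  have hc := hN.continuousOn_amp_mul_pow (s := s) hK hφ m
  intro p hp
  simp only [contourGammaIn, List.mem_cons, List.not_mem_nil, or_false] at hp
  rcases hp with rfl | rfl | rfl
  · simp only [deriv_const_mul_ofReal]
    rw [integrableOn_Iic_neg_iff]
    refine Integrable.mul_const ?_ _
    have := (ray_in hε hδ).integrableOn_amp_rotate hR hδ hδ' hN hs hφ hlim m
    have e : ∀ r : ℝ, -alpha * Complex.exp ((-1 * δ : ℝ) * Complex.I) * r =
        alpha * Complex.exp (-(Complex.I * δ)) * (-r : ℝ) := fun r => by
      rw [show ((-1 * δ : ℝ) : ℂ) * Complex.I = -(Complex.I * δ) by push_cast; ring]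
      push_cast; ring
    simpa only [IntegrableOn, e] using this
  · refine ContinuousOn.integrableOn_Icc ?_
    simp only [deriv_arc]
    exact continuousOn_arc hc fun u hu =>
      arc_mem_sectorS ⟨by linarith [hu.1], by linarith [hu.2]⟩
  · simp only [deriv_const_mul_ofReal]
    refine Integrable.mul_const ?_ _
    have := (ray_out hε hδ).integrableOn_amp_rotate hR hδ hδ' hN hs hφ hlim m
    simpa only [IntegrableOn, one_mul, mul_comm (δ : ℂ)] using this

theorem integrableOn_arc (hc : IntegrableOn
      (fun u : ℝ => θ (R * Complex.exp (-(Complex.I * u)))) (Icc (π / 3) (2 * π / 3)))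
    {f : ℂ → ℂ} (hf : ContinuousOn f (stripS R ε)) :
    IntegrableOn (fun u : ℝ => f (R * Complex.exp (-(Complex.I * u))) *
      θ (R * Complex.exp (-(Complex.I * u))) *
        -(R * Complex.exp (-(Complex.I * u)) * Complex.I)) (Icc (π / 3) (2 * π / 3)) := by
  have h := hc.continuousOn_mul
    (continuousOn_arc (a := π / 3) (b := 2 * π / 3) hf fun u hu => arc_mem_stripS hu)
    isCompact_Icc
  simpa only [mul_right_comm] using h

theorem converges_bdryD (hR : 0 < R) (hε : 0 < ε) (hδ : 0 < δ) (hN : Phase N I R ε δ)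
    (hψ : MemLp ψ 1 (bdryD R).arcLength)
    (hO : ψ =O[cobounded ℂ ⊓ 𝓟 (bdryD R).carrier] fun z => z ^ (-4 : ℤ)) {m : ℕ} (hm : m ≤ 2) :
    (bdryD R).Converges fun z => amp t ψ z * N z ^ m := by
  have hK : ∀ z ∈ stripS R ε, R ≤ ‖z‖ := fun z hz => le_norm_of_mem (δ := δ) hR (.inl hz)
  intro p hp
  obtain ⟨d, hd0, hd, hpc⟩ := norm_deriv_bdryD hR hp
  have hi := Contour.integrableOn_of_memLp hp hψ hd0 hd hpc
  have hcar : ∀ u ∈ p.dom, p.path u ∈ (bdryD R).carrier := fun u hu => ⟨p, hp, u, hu, rfl⟩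
  simp only [bdryD, List.mem_cons, List.not_mem_nil, or_false] at hp
  rcases hp with rfl | rfl | rfl
  · simp only [deriv_const_mul_ofReal]
    rw [integrableOn_Iic_neg_iff] at hi ⊢
    refine Integrable.mul_const ?_ _
    have e : ∀ r : ℝ, alpha * (-r : ℝ) = -alpha * r := fun r => by push_cast; ring
    simp only [e] at hi ⊢
    refine (ray_in hε hδ).integrableOn_amp_mul_pow hR hN (fun r hr => ?_) hi hO hm
    rw [← e]
    exact hcar (-r) (neg_le_neg hr)
  · simp only [deriv_arc]
    have hf : ContinuousOn (fun z => Complex.exp (-(Complex.I * z ^ 3 * t)) * N z ^ m)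
        (stripS R ε) := ContinuousOn.mul (by fun_prop) ((hN.continuousOn.mono hK).pow m)
    simpa only [amp, mul_right_comm _ (N _ ^ m)] using integrableOn_arc hi hf
  · simp only [deriv_const_mul_ofReal]
    refine Integrable.mul_const ?_ _
    exact (ray_out hε hδ).integrableOn_amp_mul_pow hR hN (fun r hr => hcar r hr) hi hO hm

theorem converges_bdryD_amp (hR : 0 < R) (hε : 0 < ε) (hδ : 0 < δ)
    (hθ : MemLp θ 1 (bdryD R).arcLength) : (bdryD R).Converges (amp t θ) := by
  intro p hp
  obtain ⟨d, hd0, hd, hpc⟩ := norm_deriv_bdryD hR hp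
  have hi := Contour.integrableOn_of_memLp hp hθ hd0 hd hpc
  simp only [bdryD, List.mem_cons, List.not_mem_nil, or_false] at hp
  rcases hp with rfl | rfl | rfl
  · simp only [deriv_const_mul_ofReal]
    rw [integrableOn_Iic_neg_iff] at hi ⊢
    refine Integrable.mul_const ?_ _
    have e : ∀ r : ℝ, alpha * (-r : ℝ) = -alpha * r := fun r => by push_cast; ring
    simp only [e] at hi ⊢
    exact (ray_in hε hδ).integrableOn_amp hi
  · simp only [deriv_arc]
    exact integrableOn_arc (ε := ε) hi (f := fun z => Complex.exp (-(Complex.I * z ^ 3 * t)))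
      (by fun_prop)
  · simp only [deriv_const_mul_ofReal]
    exact Integrable.mul_const ((ray_out hε hδ).integrableOn_amp hi) _

end Convergence

/-! ### Deformation of the whole contour and the limit -/

section Deformation
variable {R ε δ t τ τ' : ℝ} {N φ φt θ ψ : ℂ → ℂ} {I : Set ℝ}

/-- The factor `e^{-i z³ t}` absorbs the exponentials in the representation of `θ`. The resulting
parameters `t - τ'` and `t - τ` have opposite signs when `τ' < t < τ`, hence the two different
directions of deformation. -/
theorem amp_eq_of_eq {z : ℂ} (h : θ z = Complex.exp (Complex.I * z ^ 3 * τ') * φ z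
    + Complex.exp (Complex.I * z ^ 3 * τ) * φt z + ψ z) :
    amp t θ z = amp (t - τ') φ z + amp (t - τ) φt z + amp t ψ z := by
  have e : ∀ s : ℝ, Complex.exp (-(Complex.I * z ^ 3 * (t - s : ℝ))) =
      Complex.exp (-(Complex.I * z ^ 3 * t)) * Complex.exp (Complex.I * z ^ 3 * s) := fun s => by
    rw [← Complex.exp_add]; congr 1; push_cast; ring
  simp only [amp, h, e]
  ring

/-- Deformation of the integral along `∂D` into integrals along `∂D`, `Γ` and `γ`. -/
theorem integral_bdryD_eq (hR : 0 < R) (hε : 0 < ε) (hδ : 0 < δ)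
    (hδ' : δ < π / 6) (hN : Phase N I R ε δ) (ht : t ∈ Ioo τ' τ)
    (hφ : ContinuousOn φ (stripS R ε)) (hφ' : DifferentiableOn ℂ φ (interior (stripS R ε)))
    (hφ_lim : Tendsto φ (cobounded ℂ ⊓ 𝓟 (stripS R ε)) (𝓝 0))
    (hφt : ContinuousOn φt (sectorS R δ)) (hφt' : DifferentiableOn ℂ φt (interior (sectorS R δ)))
    (hφt_lim : Tendsto φt (cobounded ℂ ⊓ 𝓟 (sectorS R δ)) (𝓝 0))
    (hθ : MemLp θ 1 (bdryD R).arcLength) (hψ : MemLp ψ 1 (bdryD R).arcLength)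
    (hrep : ∀ᵐ z ∂(bdryD R).arcLength,
      θ z = Complex.exp (Complex.I * z ^ 3 * τ') * φ z
        + Complex.exp (Complex.I * z ^ 3 * τ) * φt z + ψ z)
    {x : ℝ} (hx : x ∈ I) {Fθ Fφ Fφt Fψ : ℂ → ℂ}
    (hFθ : Fθ = fun z => Complex.exp (Complex.I * N z * x) * amp t θ z)
    (hFφ : Fφ = fun z => Complex.exp (Complex.I * N z * x) * amp (t - τ') φ z)
    (hFφt : Fφt = fun z => Complex.exp (Complex.I * N z * x) * amp (t - τ) φt z)
    (hFψ : Fψ = fun z => Complex.exp (Complex.I * N z * x) * amp t ψ z) :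
    (bdryD R).integral Fθ = (bdryD R).integral Fψ + (contourGamma R ε).integral Fφ
      + (contourGammaIn R δ).integral Fφt := by
  have hπ := Real.pi_pos
  have hrep' : ∀ᵐ z ∂(bdryD R).arcLength,
      amp t θ z = amp (t - τ') φ z + amp (t - τ) φt z + amp t ψ z :=
    hrep.mono fun z hz => amp_eq_of_eq hz
  obtain ⟨M, -, hM⟩ := hN.im
  have hpb : (bdryD R).PhaseBound N I M :=
    Contour.phaseBound hR hN hM fun p hp => bdryD_mem hε hδ hp
  have hint : ∀ {f : ℂ → ℂ}, MemLp f 1 (bdryD R).arcLength → ∀ p ∈ bdryD R,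
      IntegrableOn (fun u => f (p.path u)) p.dom := fun hf p hp => by
    obtain ⟨d, hd0, hd, hpc⟩ := norm_deriv_bdryD hR hp
    exact Contour.integrableOn_of_memLp hp hf hd0 hd hpc
  have hae : ∀ p ∈ bdryD R, ∀ᵐ u ∂volume.restrict p.dom, amp t θ (p.path u) =
      amp (t - τ') φ (p.path u) + amp (t - τ) φt (p.path u) + amp t ψ (p.path u) :=
    fun p hp => by
      obtain ⟨d, hd0, hd, hpc⟩ := norm_deriv_bdryD hR hp
      exact Contour.ae_of_ae_arcLength hp hrep' hd0 hd hpc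
  have hψc := (converges_bdryD_amp (t := t) hR hε hδ hψ).exp_mul hpb hx
  simp only [bdryD, List.forall_mem_cons, List.not_mem_nil, false_imp_iff, implies_true,
    and_true, Contour.Converges] at hint hae hψc
  have cφ : ContinuousOn Fφ (stripS R ε) := hFφ ▸ hN.continuousOn_exp_mul_amp
    (fun z hz => le_norm_of_mem (δ := δ) hR (.inl hz)) hφ x
  have cφt : ContinuousOn Fφt (sectorS R δ) := hFφt ▸ hN.continuousOn_exp_mul_amp
    (fun z hz => le_norm_of_mem (ε := ε) hR (.inr hz)) hφt x
  have kφ := continuousOn_arc cφ fun u (hu : u ∈ Icc (π / 3) (2 * π / 3)) => arc_mem_stripS hu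
  have kφt := continuousOn_arc cφt fun u (hu : u ∈ Icc (π / 3) (2 * π / 3)) => arc_mem_sectorS hu
  have hle : π / 3 ≤ 2 * π / 3 := by linarith
  -- the arc
  have harc : arcIntegral R Fθ (π / 3) (2 * π / 3) = arcIntegral R Fψ (π / 3) (2 * π / 3)
      + arcIntegral R Fφ (π / 3) (2 * π / 3) + arcIntegral R Fφt (π / 3) (2 * π / 3) := by
    rw [← uIcc_of_le hle] at kφ kφt
    have jψ : IntervalIntegrable (fun u : ℝ => Fψ (R * Complex.exp (-(Complex.I * u))) *
        -(R * Complex.exp (-(Complex.I * u)) * Complex.I)) volume (π / 3) (2 * π / 3) := by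
      rw [intervalIntegrable_iff_integrableOn_Icc_of_le hle]
      simpa only [deriv_arc, hFψ] using hψc.2.1
    rw [arcIntegral, arcIntegral, arcIntegral, arcIntegral,
      ← intervalIntegral.integral_add jψ kφ.intervalIntegrable,
      ← intervalIntegral.integral_add (jψ.add kφ.intervalIntegrable) kφt.intervalIntegrable]
    refine intervalIntegral.integral_congr_ae_restrict ?_
    rw [uIoc_of_le hle]
    refine (ae_restrict_of_ae_restrict_of_subset Ioc_subset_Icc_self hae.2.1).mono fun u hu => ?_
    simp only [hFθ, hFφ, hFφt, hFψ, hu]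
    ring
  -- For `φt` the arc is cut in three: the middle part belongs to `γ`, and the two ends cancel
  -- against the arcs swept out by rotating the rays. For `φ` the whole arc belongs to `Γ`.
  have hadd1 := arcIntegral_add (a := π / 3) (b := π / 3 + δ) (c := 2 * π / 3) (f := Fφt)
    (by linarith) (by linarith) kφt
  have hadd2 := arcIntegral_add (a := π / 3 + δ) (b := 2 * π / 3 - δ) (c := 2 * π / 3) (f := Fφt)
    (by linarith) (by linarith) (kφt.mono (Icc_subset_Icc_left (by linarith)))
  -- the incoming ray
  have e : ∀ r : ℝ, alpha * (-r : ℝ) = -alpha * r := fun r => by push_cast; ring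
  have hin := (ray_in hε hδ).integral_eq hR hε hδ hδ' hN ht hφ hφ' hφ_lim hφt hφt' hφt_lim
    (by simpa only [integrableOn_Iic_neg_iff, e] using (hint hθ).1)
    (by simpa only [integrableOn_Iic_neg_iff, e] using (hint hψ).1)
    (by simpa only [e] using ae_restrict_Ici_of_Iic_neg hae.1) hx hFθ hFφ hFφt hFψ
  rw [integral_rotated_arc R Fφt (b := π / 3) (by rw [neg_alpha_eq_exp]; push_cast; rfl)] at hin
  simp only [neg_mul (1 : ℝ), one_mul, neg_neg, sub_neg_eq_add] at hin
  -- the outgoing ray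
  have hout := (ray_out hε hδ).integral_eq hR hε hδ hδ' hN ht hφ hφ' hφ_lim hφt hφt' hφt_lim
    (hint hθ).2.2 (hint hψ).2.2 hae.2.2 hx hFθ hFφ hFφt hFψ
  rw [integral_rotated_arc R Fφt (b := 2 * π / 3)
    (by rw [alpha_sq_eq_exp]; push_cast; rfl)] at hout
  simp only [one_mul] at hout
  have hsymm : arcIntegral R Fφt (π / 3 + δ) (π / 3) = -arcIntegral R Fφt (π / 3) (π / 3 + δ) :=
    intervalIntegral.integral_symm _ _
  rw [integral_bdryD, integral_bdryD, integral_contourGamma R hε, integral_contourGammaIn hδ',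
    harc, hin, hout, hsymm]
  linear_combination -hadd1 - hadd2

theorem limit_of_phase (hR : 0 < R) (hε : 0 < ε) (hδ : 0 < δ)
    (hδ' : δ < π / 6) (hI : IsOpen I) (hN : Phase N I R ε δ) (ht : t ∈ Ioo τ' τ)
    (hφ : ContinuousOn φ (stripS R ε)) (hφ' : DifferentiableOn ℂ φ (interior (stripS R ε)))
    (hφ_lim : Tendsto φ (cobounded ℂ ⊓ 𝓟 (stripS R ε)) (𝓝 0))
    (hφt : ContinuousOn φt (sectorS R δ)) (hφt' : DifferentiableOn ℂ φt (interior (sectorS R δ)))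
    (hφt_lim : Tendsto φt (cobounded ℂ ⊓ 𝓟 (sectorS R δ)) (𝓝 0))
    (hθ : MemLp θ 1 (bdryD R).arcLength) (hψ : MemLp ψ 1 (bdryD R).arcLength)
    (hO : ψ =O[cobounded ℂ ⊓ 𝓟 (bdryD R).carrier] fun z => z ^ (-4 : ℤ))
    (hrep : ∀ᵐ z ∂(bdryD R).arcLength,
      θ z = Complex.exp (Complex.I * z ^ 3 * τ') * φ z
        + Complex.exp (Complex.I * z ^ 3 * τ) * φt z + ψ z)
    {k : ℕ} (hk : k ≤ 2) {H : ℝ → ℂ}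
    (hH : H = fun x : ℝ => (bdryD R).integral fun z =>
      Complex.exp (Complex.I * N z * x) * amp t θ z) :
    (∀ x ∈ I, (bdryD R).Converges fun z => Complex.exp (Complex.I * N z * x) * amp t θ z) ∧
    ContDiffOn ℝ k H I ∧
    Tendsto (fun x : ℝ => (-Complex.I) ^ k * iteratedDeriv k H x) (𝓝[I] 0)
      (𝓝 ((bdryD R).integral (fun z => amp t ψ z * N z ^ k)
        + (contourGamma R ε).integral (fun z => amp (t - τ') φ z * N z ^ k)
        + (contourGammaIn R δ).integral (fun z => amp (t - τ) φt z * N z ^ k))) := by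
  obtain ⟨M, -, hM⟩ := hN.im
  have b1 : (bdryD R).PhaseBound N I M :=
    Contour.phaseBound hR hN hM fun p hp => bdryD_mem hε hδ hp
  have b2 : (contourGamma R ε).PhaseBound N I M :=
    Contour.phaseBound hR hN hM fun p hp => contourGamma_mem hε hp
  have b3 : (contourGammaIn R δ).PhaseBound N I M :=
    Contour.phaseBound hR hN hM fun p hp => contourGammaIn_mem hε hδ hp
  have c1 : ∀ m ≤ k, (bdryD R).Converges fun z => amp t ψ z * N z ^ m :=
    fun m hm => converges_bdryD hR hε hδ hN hψ hO (hm.trans hk)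
  have c2 : ∀ m ≤ k, (contourGamma R ε).Converges fun z => amp (t - τ') φ z * N z ^ m :=
    fun m _ => converges_contourGamma hR hε hδ hN (sub_pos.2 ht.1) hφ hφ_lim m
  have c3 : ∀ m ≤ k, (contourGammaIn R δ).Converges fun z => amp (t - τ) φt z * N z ^ m :=
    fun m _ => converges_contourGammaIn hR hε hδ hδ' hN (sub_neg.2 ht.2) hφt hφt_lim m
  have d1 := Contour.contDiffOn_integral_exp_mul hI b1 c1
  have d2 := Contour.contDiffOn_integral_exp_mul hI b2 c2
  have d3 := Contour.contDiffOn_integral_exp_mul hI b3 c3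
  have l1 := Contour.tendsto_iteratedDeriv_integral_exp_mul hI b1 c1
  have l2 := Contour.tendsto_iteratedDeriv_integral_exp_mul hI b2 c2
  have l3 := Contour.tendsto_iteratedDeriv_integral_exp_mul hI b3 c3
  have hEq : ∀ x ∈ I, H x = _ := fun x hx =>
    (congrFun hH x).trans (integral_bdryD_eq hR hε hδ hδ' hN ht hφ hφ' hφ_lim hφt hφt'
      hφt_lim hθ hψ hrep hx rfl rfl rfl rfl)
  refine ⟨fun x hx => (converges_bdryD_amp hR hε hδ hθ).exp_mul b1 hx,
    ((d1.add d2).add d3).congr hEq, ((l1.add l2).add l3).congr' ?_⟩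
  filter_upwards [self_mem_nhdsWithin] with x hx
  -- The deformed expression agrees with `H` on the open set `I`, so their iterated derivatives
  -- agree there too.
  have hev := (eventuallyEq_of_mem (hI.mem_nhds hx) hEq).iteratedDeriv_eq k
  have hnx := hI.mem_nhds hx
  rw [hev]
  have s1 := d1.contDiffAt hnx
  have s2 := d2.contDiffAt hnx
  have s3 := d3.contDiffAt hnx
  rw [← mul_add, ← mul_add, ← iteratedDeriv_add s1 s2]
  exact congrArg _ (iteratedDeriv_add (s1.add s2) s3).symm

end Deformation

end LKdV

/-! ### The limits at `x = 0` from either side -/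

open LKdV in
theorem mainTheorem4 (a R ε δ τ' τ : ℝ)
    (hR : 0 < R) (hRa : 4 * |a| ^ 3 < 27 * R ^ 6) (hε : 0 < ε) (hδ : 0 < δ) (hδ' : δ < π / 6)
    (hτ' : 0 ≤ τ') (hτ : τ' < τ)
    (θ φ φt ψ : ℂ → ℂ)
    (hθ_one : MemLp θ 1 (bdryD R).arcLength) (hθ_top : MemLp θ ⊤ (bdryD R).arcLength)
    (hψ_one : MemLp ψ 1 (bdryD R).arcLength) (hψ_top : MemLp ψ ⊤ (bdryD R).arcLength)
    (hψ : ψ =O[cobounded ℂ ⊓ 𝓟 (bdryD R).carrier] fun z => z ^ (-4 : ℤ))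
    (hφ_cont : ContinuousOn φ (stripS R ε))
    (hφ_hol : DifferentiableOn ℂ φ (interior (stripS R ε)))
    (hφ_lim : Tendsto φ (cobounded ℂ ⊓ 𝓟 (stripS R ε)) (𝓝 0))
    (hφt_cont : ContinuousOn φt (sectorS R δ))
    (hφt_hol : DifferentiableOn ℂ φt (interior (sectorS R δ)))
    (hφt_lim : Tendsto φt (cobounded ℂ ⊓ 𝓟 (sectorS R δ)) (𝓝 0))
    (hθ : ∀ᵐ z ∂(bdryD R).arcLength,
      θ z = Complex.exp (Complex.I * z ^ 3 * τ') * φ z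
        + Complex.exp (Complex.I * z ^ 3 * τ) * φt z + ψ z)
    (k : ℕ) (hk : k ∈ ({0, 1, 2} : Set ℕ)) (t : ℝ) (ht : t ∈ Ioo τ' τ) :
    -- all integrals on the right-hand sides converge absolutely
    (∀ j ∈ ({0, 1, 2} : Set ℕ),
      (bdryD R).Converges (fun z =>
        Complex.exp (-(Complex.I * z ^ 3 * t)) * ψ z * nu a (alpha ^ j * z) ^ k) ∧
      (contourGamma R ε).Converges (fun z =>
        Complex.exp (-(Complex.I * z ^ 3 * (t - τ'))) * φ z * nu a (alpha ^ j * z) ^ k) ∧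
      (contourGammaIn R δ).Converges (fun z =>
        Complex.exp (Complex.I * z ^ 3 * (τ - t)) * φt z * nu a (alpha ^ j * z) ^ k)) ∧
    -- the cases `j = 1, 2`, with `x → 0⁺`
    (∀ j ∈ ({1, 2} : Set ℕ),
      (∀ x : ℝ, 0 < x → (bdryD R).Converges (fun z => kernelE a j x t z * θ z)) ∧
      ContDiffOn ℝ k (bdryIntegral a R j t θ) (Ioi 0) ∧
      Tendsto (fun x : ℝ => (-Complex.I) ^ k * iteratedDeriv k (bdryIntegral a R j t θ) x)
        (𝓝[>] 0)
        (𝓝 ((bdryD R).integral (fun z =>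
              Complex.exp (-(Complex.I * z ^ 3 * t)) * ψ z * nu a (alpha ^ j * z) ^ k)
          + (contourGamma R ε).integral (fun z =>
              Complex.exp (-(Complex.I * z ^ 3 * (t - τ'))) * φ z * nu a (alpha ^ j * z) ^ k)
          + (contourGammaIn R δ).integral (fun z =>
              Complex.exp (Complex.I * z ^ 3 * (τ - t)) * φt z
                * nu a (alpha ^ j * z) ^ k)))) ∧
    -- the case `j = 0`, with `x → 0⁻`
    ((∀ x : ℝ, x < 0 → (bdryD R).Converges (fun z => kernelE a 0 x t z * θ z)) ∧
      ContDiffOn ℝ k (bdryIntegral a R 0 t θ) (Iio 0) ∧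
      Tendsto (fun x : ℝ => (-Complex.I) ^ k * iteratedDeriv k (bdryIntegral a R 0 t θ) x)
        (𝓝[<] 0)
        (𝓝 ((bdryD R).integral (fun z =>
              Complex.exp (-(Complex.I * z ^ 3 * t)) * ψ z * nu a z ^ k)
          + (contourGamma R ε).integral (fun z =>
              Complex.exp (-(Complex.I * z ^ 3 * (t - τ'))) * φ z * nu a z ^ k)
          + (contourGammaIn R δ).integral (fun z =>
              Complex.exp (Complex.I * z ^ 3 * (τ - t)) * φt z * nu a z ^ k)))) := by
  have hk2 : k ≤ 2 := by
    rcases hk with rfl | rfl | rfl <;> norm_num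
  have e1 : ∀ z, Complex.exp (-(Complex.I * z ^ 3 * t)) * ψ z = amp t ψ z := fun z => rfl
  have e2 : ∀ z, Complex.exp (-(Complex.I * z ^ 3 * (t - τ'))) * φ z = amp (t - τ') φ z :=
    fun z => by rw [amp, Complex.ofReal_sub]
  have e3 : ∀ z, Complex.exp (Complex.I * z ^ 3 * (τ - t)) * φt z = amp (t - τ) φt z :=
    fun z => by rw [amp, Complex.ofReal_sub]; congr 2; ring
  have e4 : ∀ (j : ℕ) (x : ℝ) (z : ℂ), kernelE a j x t z * θ z =
      Complex.exp (Complex.I * nu a (alpha ^ j * z) * x) * amp t θ z := fun j x z => by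
    rw [amp, ← mul_assoc, ← Complex.exp_add, kernelE, sub_eq_add_neg]
  have hH : ∀ j : ℕ, bdryIntegral a R j t θ = fun x : ℝ => (bdryD R).integral fun z =>
      Complex.exp (Complex.I * nu a (alpha ^ j * z) * x) * amp t θ z := fun j => by
    ext x
    simp only [bdryIntegral, e4]
  -- Writing `ν(z)` as `ν(α^0 z)` puts the case `x → 0⁻` in the same form as `j = 1, 2`; only the
  -- half-line changes.
  have hneg : Phase (fun z => nu a (alpha ^ 0 * z)) (Iio 0) R ε δ := phase_nu_neg hR hRa hε hδ'
  -- The right-hand integrals do not involve `x`, so for each `j` a phase on either half-line is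
  -- enough.
  have hconv : ∀ (j : ℕ) (I : Set ℝ), Phase (fun z => nu a (alpha ^ j * z)) I R ε δ →
      (bdryD R).Converges (fun z => amp t ψ z * nu a (alpha ^ j * z) ^ k) ∧
      (contourGamma R ε).Converges (fun z => amp (t - τ') φ z * nu a (alpha ^ j * z) ^ k) ∧
      (contourGammaIn R δ).Converges (fun z => amp (t - τ) φt z * nu a (alpha ^ j * z) ^ k) :=
    fun j I hN => ⟨converges_bdryD hR hε hδ hN hψ_one hψ hk2,
      converges_contourGamma hR hε hδ hN (sub_pos.2 ht.1) hφ_cont hφ_lim k,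
      converges_contourGammaIn hR hε hδ hδ' hN (sub_neg.2 ht.2) hφt_cont hφt_lim k⟩
  simp only [e1, e2, e3, e4]
  refine ⟨fun j hj => ?_, fun j hj => ?_, ?_⟩
  · rcases hj with rfl | hj
    · exact hconv 0 _ hneg
    · exact hconv j _ (phase_nu_pos hR hRa hε hδ' hj)
  · exact limit_of_phase hR hε hδ hδ' isOpen_Ioi (phase_nu_pos hR hRa hε hδ' hj) ht hφ_cont
      hφ_hol hφ_lim hφt_cont hφt_hol hφt_lim hθ_one hψ_one hψ hθ hk2 (hH j)
  · have := limit_of_phase hR hε hδ hδ' isOpen_Iio hneg ht hφ_cont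
      hφ_hol hφ_lim hφt_cont hφt_hol hφt_lim hθ_one hψ_one hψ hθ hk2 (hH 0)
    simpa only [pow_zero, one_mul, mem_Iio] using this
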